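/- Let $H^2(\mathbb S_{-\pi,0})$ be the Hardy space of the strip $\mathbb R+i(-\pi,0)$: the analytic functions $\xi$ on the strip with $\sup_{-\pi<\lambda<0}\|\xi(\cdot+i\lambda)\|_{L^2(\mathbb R)}<\infty$. Such a $\xi$ has $L^2$-boundary values $\xi(\theta)=\lim_{\epsilon\downarrow0}\xi(\theta-i\epsilon)$ and $\xi(\theta-\pi i)=\lim_{\epsilon\downarrow0}\xi(\theta-(\pi-\epsilon)i)$, and is identified with $\xi(\theta)\in L^2(\mathbb R)$. Let $\Delta^{1/2}$ be the operator on $L^2(\mathbb R)$ with domain $H^2(\mathbb S_{-\pi,0})$ and $(\Delta^{1/2}\xi)(\theta)=\xi(\theta-\pi i)$. For real $\alpha,\beta\ge 0$, not both zero, put $$f(\zeta)=\exp\left(i\alpha e^{-\zeta}-i\beta e^{\zeta}\right)$$ (the singular inner function with atoms only at $0$ and $\infty$), and let $M_{\overline f}$ be multiplication by $\overline{f(\theta)}$ on $L^2(\mathbb R)$. For a symmetric operator $A$ let $n_\pm(A)=\dim\ker(A^*\mp i)\in\{0,1,2,\dots,\infty\}$. Then $A=M_{\overline f}\Delta^{1/2}$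 is densely defined and symmetric, and $n_+(A)=n_-(A)=\infty$. Explicitly, for a real, even, smooth function $\kappa$ on $\mathbb R$ with $\int\kappa(t)\,dt=0$ write $\hat\kappa(p)=\frac1{\sqrt{2\pi}}\int e^{-itp}\kappa(t)\,dt$. (a) If $\alpha>0$ and $\kappa$ is supported in $(-\frac\alpha3,\frac\alpha3)$, then for every integer $n\ge0$ the function $$\xi_{\kappa,n}(\theta)=\hat\kappa(e^{-\theta})\exp\left(-\tfrac{i\alpha}2e^{-\theta}+\tfrac{i\beta}2e^{\theta}\right)e^{-(n+\frac12)\theta}$$ is in $L^2(\mathbb R)$, lies in the domain of $A^*$ and satisfies $A^*\xi_{\kappa,n}=(-1)^n i\,\xi_{\kappa,n}$; if $\kappa\ne0$, the vectors $\xi_{\kappa,n}$, $n\ge0$, are linearly independent. (b) If $\beta>0$ and $\kappa$ is supported in $(-\frac\beta3,\frac\beta3)$, then for every integer $n\ge0$ the function $$\eta_{\kappa,n}(\theta)=\hat\kappa(e^{\theta})\exp\left(-\tfrac{i\alpha}2e^{-\theta}+\tfrac{i\beta}2e^{\theta}\right)e^{(n+\frac12)\theta}$$ is in $L^2(\mathbb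 R)$, lies in the domain of $A^*$ and satisfies $A^*\eta_{\kappa,n}=(-1)^{n+1} i\,\eta_{\kappa,n}$; if $\kappa\ne0$, the vectors $\eta_{\kappa,n}$, $n\ge0$, are linearly independent. -/

import Mathlib

open MeasureTheory Filter Topology
open scoped ENNReal NNReal ContDiff

noncomputable section

namespace StripOperator

/-- The Hilbert space `L²(ℝ)` of complex-valued functions, with Lebesgue measure. -/
abbrev L2 : Type := Lp ℂ 2 (volume : Measure ℝ)

/-- The strip `ℝ + i(-π, 0)`. -/
def strip : Set ℂ := {ζ | -Real.pi < ζ.im ∧ ζ.im < 0}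

/-- `F` belongs to the Hardy space `H²` of the strip `ℝ + i(-π, 0)`: it is analytic there and the
`L²`-norms of its restrictions to the horizontal lines are uniformly bounded.
(Values of `F` outside the strip are irrelevant.) -/
structure MemHardy (F : ℂ → ℂ) : Prop where
  analytic : DifferentiableOn ℂ F strip
  bounded : ∃ C : ℝ≥0, ∀ y : ℝ, -Real.pi < y → y < 0 →
    eLpNorm (fun θ : ℝ => F (θ + y * Complex.I)) 2 volume ≤ C

/-- `ξ ∈ L²(ℝ)` is the upper boundary value `F(θ)`: the `L²`-limit of `F(· - iε)`. -/
def IsUpperBoundaryValue (F : ℂ → ℂ) (ξ : L2) : Prop :=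
  Tendsto (fun ε : ℝ => eLpNorm (fun θ : ℝ => F (θ - ε * Complex.I) - ξ θ) 2 volume)
    (𝓝[>] 0) (𝓝 0)

/-- `η ∈ L²(ℝ)` is the lower boundary value `F(θ - πi)`: the `L²`-limit of `F(· - (π - ε)i)`. -/
def IsLowerBoundaryValue (F : ℂ → ℂ) (η : L2) : Prop :=
  Tendsto (fun ε : ℝ =>
      eLpNorm (fun θ : ℝ => F (θ - (Real.pi - ε) * Complex.I) - η θ) 2 volume)
    (𝓝[>] 0) (𝓝 0)

theorem MemHardy.aestronglyMeasurable {F : ℂ → ℂ} (hF : MemHardy F) {y : ℝ}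
    (h1 : -Real.pi < y) (h2 : y < 0) :
    AEStronglyMeasurable (fun θ : ℝ => F (θ + y * Complex.I)) volume := by
  apply Continuous.aestronglyMeasurable
  have hc : Continuous (fun θ : ℝ => (θ + y * Complex.I : ℂ)) := by fun_prop
  refine hF.analytic.continuousOn.comp_continuous hc fun θ => ?_
  simp [strip, h1, h2]

theorem MemHardy.zero : MemHardy (fun _ => 0) :=
  ⟨differentiableOn_const 0, 0, fun y _ _ => by simp⟩

theorem MemHardy.add {F G : ℂ → ℂ} (hF : MemHardy F) (hG : MemHardy G) :
    MemHardy (fun ζ => F ζ + G ζ) := by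
  obtain ⟨C, hC⟩ := hF.bounded
  obtain ⟨D, hD⟩ := hG.bounded
  refine ⟨hF.analytic.add hG.analytic, C + D, fun y h1 h2 => ?_⟩
  refine (eLpNorm_add_le (hF.aestronglyMeasurable h1 h2) (hG.aestronglyMeasurable h1 h2)
    (by norm_num)).trans ?_
  push_cast
  exact add_le_add (hC y h1 h2) (hD y h1 h2)

theorem MemHardy.smul {F : ℂ → ℂ} (c : ℂ) (hF : MemHardy F) :
    MemHardy (fun ζ => c * F ζ) := by
  obtain ⟨C, hC⟩ := hF.bounded
  refine ⟨hF.analytic.const_mul c, ‖c‖₊ * C, fun y h1 h2 => ?_⟩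
  have := eLpNorm_const_smul c (fun θ : ℝ => F (θ + y * Complex.I)) 2 volume
  simp only [Pi.smul_def, smul_eq_mul] at this
  rw [this, ENNReal.coe_mul]
  exact mul_le_mul_right (hC y h1 h2) _

/-- Limits in the `L²`-sense are additive. -/
theorem tendsto_eLpNorm_add {u v : ℝ → ℝ → ℂ} {ξ η : L2}
    (hu : ∀ᶠ ε : ℝ in 𝓝[>] 0, AEStronglyMeasurable (u ε) volume)
    (hv : ∀ᶠ ε : ℝ in 𝓝[>] 0, AEStronglyMeasurable (v ε) volume)
    (h1 : Tendsto (fun ε : ℝ => eLpNorm (fun θ => u ε θ - ξ θ) 2 volume) (𝓝[>] 0) (𝓝 0))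
    (h2 : Tendsto (fun ε : ℝ => eLpNorm (fun θ => v ε θ - η θ) 2 volume) (𝓝[>] 0) (𝓝 0)) :
    Tendsto (fun ε : ℝ => eLpNorm (fun θ => (u ε θ + v ε θ) - (ξ + η : L2) θ) 2 volume)
      (𝓝[>] 0) (𝓝 0) := by
  have h3 := h1.add h2
  rw [add_zero] at h3
  refine tendsto_of_tendsto_of_tendsto_of_le_of_le' tendsto_const_nhds h3
    (Eventually.of_forall fun _ => zero_le) ?_
  filter_upwards [hu, hv] with ε hue hve
  refine le_trans (le_of_eq ?_) (eLpNorm_add_le (hue.sub (Lp.aestronglyMeasurable ξ))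
    (hve.sub (Lp.aestronglyMeasurable η)) (by norm_num))
  apply eLpNorm_congr_ae
  filter_upwards [Lp.coeFn_add ξ η] with θ hθ
  simp only [hθ, Pi.add_apply]
  ring

/-- Limits in the `L²`-sense are homogeneous. -/
theorem tendsto_eLpNorm_smul {u : ℝ → ℝ → ℂ} {ξ : L2} (c : ℂ)
    (h1 : Tendsto (fun ε : ℝ => eLpNorm (fun θ => u ε θ - ξ θ) 2 volume) (𝓝[>] 0) (𝓝 0)) :
    Tendsto (fun ε : ℝ => eLpNorm (fun θ => c * u ε θ - (c • ξ : L2) θ) 2 volume)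
      (𝓝[>] 0) (𝓝 0) := by
  have h3 := ENNReal.Tendsto.const_mul (a := (‖c‖₊ : ℝ≥0∞)) h1 (Or.inr ENNReal.coe_ne_top)
  rw [mul_zero] at h3
  refine h3.congr fun ε => ?_
  have := eLpNorm_const_smul c (fun θ : ℝ => u ε θ - ξ θ) 2 volume
  refine (Eq.trans ?_ this).symm
  apply eLpNorm_congr_ae
  filter_upwards [Lp.coeFn_smul c ξ] with θ hθ
  simp only [hθ, Pi.smul_apply, smul_eq_mul]
  ring

theorem MemHardy.upper_meas {F : ℂ → ℂ} (hF : MemHardy F) :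
    ∀ᶠ ε : ℝ in 𝓝[>] 0, AEStronglyMeasurable (fun θ : ℝ => F (θ - ε * Complex.I)) volume := by
  filter_upwards [Ioo_mem_nhdsGT Real.pi_pos] with ε hε
  have := hF.aestronglyMeasurable (y := -ε) (by linarith [hε.2]) (by linarith [hε.1])
  convert this using 4
  push_cast
  ring

theorem MemHardy.lower_meas {F : ℂ → ℂ} (hF : MemHardy F) :
    ∀ᶠ ε : ℝ in 𝓝[>] 0,
      AEStronglyMeasurable (fun θ : ℝ => F (θ - (Real.pi - ε) * Complex.I)) volume := by
  filter_upwards [Ioo_mem_nhdsGT Real.pi_pos] with ε hε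
  have := hF.aestronglyMeasurable (y := ε - Real.pi) (by linarith [hε.1]) (by linarith [hε.2])
  convert this using 4
  push_cast
  ring

/-- The graph of the analytic continuation `ξ(θ) ↦ ξ(θ - πi)` on the Hardy space, an element of
which is identified with its upper boundary value in `L²(ℝ)`. -/
def continuationGraph : Submodule ℂ (L2 × L2) where
  carrier := {p | ∃ F : ℂ → ℂ, MemHardy F ∧ IsUpperBoundaryValue F p.1 ∧
    IsLowerBoundaryValue F p.2}
  zero_mem' := by
    refine ⟨fun _ => 0, MemHardy.zero, ?_, ?_⟩
    · refine tendsto_const_nhds.congr fun ε => ?_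
      rw [← eLpNorm_zero (α := ℝ) (ε := ℂ) (p := 2) (μ := volume)]
      apply eLpNorm_congr_ae
      filter_upwards [Lp.coeFn_zero ℂ 2 (volume : Measure ℝ)] with θ _
      simp
    · refine tendsto_const_nhds.congr fun ε => ?_
      rw [← eLpNorm_zero (α := ℝ) (ε := ℂ) (p := 2) (μ := volume)]
      apply eLpNorm_congr_ae
      filter_upwards [Lp.coeFn_zero ℂ 2 (volume : Measure ℝ)] with θ _
      simp
  add_mem' := by
    rintro p q ⟨F, hF, hF1, hF2⟩ ⟨G, hG, hG1, hG2⟩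
    exact ⟨fun ζ => F ζ + G ζ, hF.add hG,
      tendsto_eLpNorm_add hF.upper_meas hG.upper_meas hF1 hG1,
      tendsto_eLpNorm_add hF.lower_meas hG.lower_meas hF2 hG2⟩
  smul_mem' := by
    rintro c p ⟨F, hF, hF1, hF2⟩
    exact ⟨fun ζ => c * F ζ, hF.smul c, tendsto_eLpNorm_smul c hF1, tendsto_eLpNorm_smul c hF2⟩

/-- The operator `Δ^{1/2}` of analytic continuation: its domain is the Hardy space of the strip
`ℝ + i(-π, 0)`, and `(Δ^{1/2} ξ)(θ) = ξ(θ - πi)`. -/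
def deltaHalf : L2 →ₗ.[ℂ] L2 := continuationGraph.toLinearPMap

/-- The bounded multiplication operator on `L²(ℝ)` by a function `g ∈ L^∞(ℝ)`. -/
def mulOp (g : Lp ℂ ∞ (volume : Measure ℝ)) : L2 →L[ℂ] L2 :=
  (ContinuousLinearMap.mul ℂ ℂ).holderL volume ∞ 2 2 g

/-- The function `f(ζ) = exp(iα e^{-ζ} - iβ e^{ζ})`. -/
def singularInner (α β : ℝ) (ζ : ℂ) : ℂ :=
  Complex.exp (Complex.I * α * Complex.exp (-ζ) - Complex.I * β * Complex.exp ζ)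

theorem norm_singularInner_ofReal (α β θ : ℝ) : ‖singularInner α β θ‖ = 1 := by
  have h : (Complex.I * α * Complex.exp (-(θ : ℂ)) - Complex.I * β * Complex.exp (θ : ℂ)) =
      ((α * Real.exp (-θ) - β * Real.exp θ : ℝ) : ℂ) * Complex.I := by
    push_cast
    ring
  rw [singularInner, h, Complex.norm_exp_ofReal_mul_I]

theorem memLp_conj_singularInner (α β : ℝ) :
    MemLp (fun θ : ℝ => (starRingEnd ℂ) (singularInner α β θ)) ∞ volume := by
  refine memLp_top_of_bound (C := 1) ?_ (Eventually.of_forall fun θ => ?_)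
  · apply Continuous.aestronglyMeasurable
    unfold singularInner
    exact Complex.continuous_conj.comp (by fun_prop)
  · rw [RCLike.norm_conj, norm_singularInner_ofReal]

/-- The operator `M_{f̄} Δ^{1/2}` for `f(ζ) = exp(iα e^{-ζ} - iβ e^{ζ})`, on the domain
of `Δ^{1/2}`; here `M_{f̄}` is the multiplication by the complex conjugate of `f(θ)`. -/
def boundStateOp (α β : ℝ) : L2 →ₗ.[ℂ] L2 :=
  (mulOp (memLp_conj_singularInner α β).toLp : L2 →ₗ[ℂ] L2).compPMap deltaHalf

/-- The eigenspace `{x ∈ dom T | T x = z x}` of a partially defined operator `T`. -/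
def eigenspace (T : L2 →ₗ.[ℂ] L2) (z : ℂ) : Submodule ℂ L2 :=
  T.graph.comap (LinearMap.prod LinearMap.id (z • LinearMap.id))

/-- The deficiency index `n₊(A) = dim ker (A* - i)`. -/
def deficiencyPlus (A : L2 →ₗ.[ℂ] L2) : ℕ∞ :=
  Cardinal.toENat (Module.rank ℂ (eigenspace A.adjoint Complex.I))

/-- The deficiency index `n₋(A) = dim ker (A* + i)`. -/
def deficiencyMinus (A : L2 →ₗ.[ℂ] L2) : ℕ∞ :=
  Cardinal.toENat (Module.rank ℂ (eigenspace A.adjoint (-Complex.I)))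

/-- Real even smooth functions supported in `(-r, r)` with vanishing integral. -/
structure IsTestFunction (r : ℝ) (κ : ℝ → ℝ) : Prop where
  smooth : ContDiff ℝ ∞ κ
  supp : Function.support κ ⊆ Set.Ioo (-r) r
  even : ∀ t, κ (-t) = κ t
  integral_zero : ∫ t, κ t = 0

/-- The Fourier transform `κ̂(p) = (2π)^{-1/2} ∫ e^{-itp} κ(t) dt`. -/
def fourierHat (κ : ℝ → ℝ) (p : ℝ) : ℂ :=
  (1 / Real.sqrt (2 * Real.pi) : ℝ) * ∫ t : ℝ, Complex.exp (-Complex.I * t * p) * (κ t : ℂ)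

/-- `κ̂(e^{-θ}) exp(-(iα/2) e^{-θ} + (iβ/2) e^{θ}) e^{-(n+1/2)θ}`. -/
def deficiencyVecZero (α β : ℝ) (κ : ℝ → ℝ) (n : ℕ) (θ : ℝ) : ℂ :=
  fourierHat κ (Real.exp (-θ)) *
    Complex.exp (-(Complex.I * α / 2) * Complex.exp (-θ) + (Complex.I * β / 2) * Complex.exp θ) *
    Complex.exp (-((n : ℂ) + 1 / 2) * θ)

/-- `κ̂(e^{θ}) exp(-(iα/2) e^{-θ} + (iβ/2) e^{θ}) e^{(n+1/2)θ}`. -/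
def deficiencyVecInfty (α β : ℝ) (κ : ℝ → ℝ) (n : ℕ) (θ : ℝ) : ℂ :=
  fourierHat κ (Real.exp θ) *
    Complex.exp (-(Complex.I * α / 2) * Complex.exp (-θ) + (Complex.I * β / 2) * Complex.exp θ) *
    Complex.exp (((n : ℂ) + 1 / 2) * θ)

end StripOperator

end

open MeasureTheory Filter Topology
open scoped ENNReal NNReal ContDiff

noncomputable section

namespace StripOperator

/-! If F and G are in H² of the strip, FG is integrable on horizontal lines, and Cauchy's theorem
says that its integrals over the two boundary lines agree. The reflection F^♯(ζ) = conj F(conj ζ -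
πi) swaps the boundary values of F and conjugates them, which turns this bilinear identity into one
about inner products (`HasBoundaryValues.integral_mul_eq`, `HasBoundaryValues.reflection`).

On the strip |f| ≤ 1, and f(θ - πi) = conj f(θ). Hence fG is a Hardy function whenever G is, and its
lower boundary value is A applied to the upper value of G; Cauchy's theorem for F^♯ and fG is the
symmetry of A. The same computation shows that A*ξ = zξ as soon as fξ is the upper boundary value of
a Hardy function with lower value zξ (`mem_eigenspace_adjoint`).

Such functions come from the square root of f, obtained by halving α and β: take G(ζ) = K(e^{sζ})
f^{1/2}(ζ) e^{s(n+1/2)ζ} with s = ±1 and K the entire extension of κ̂. Across the strip e^{sζ}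
changes sign, K is even, f^{1/2} becomes its inverse, and the half-integer exponential produces the
factor ±i. The exponential growth of K off the real axis (type r) is absorbed by the decay of
f^{1/2}, and the rapid decay of K absorbs e^{s(n+1/2)ζ} (`norm_deficiencyExt_le`). The eigenvalue
alternates with the parity of n, so both deficiency spaces contain infinitely many independent
vectors. -/

/-! ### Convergence in L² and continuity of the bilinear pairing. -/

/-- Dominated convergence to zero in `L²`. -/
theorem tendsto_eLpNorm_two_zero {u : ℝ → ℝ → ℂ} {H : ℝ → ℝ} {l : Filter ℝ}
    [l.IsCountablyGenerated] (hH : MemLp H 2 volume)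
    (hm : ∀ᶠ ε in l, AEStronglyMeasurable (u ε) volume)
    (hb : ∀ᶠ ε in l, ∀ᵐ θ : ℝ, ‖u ε θ‖ ≤ H θ)
    (hlim : ∀ᵐ θ : ℝ, Tendsto (fun ε => u ε θ) l (𝓝 0)) :
    Tendsto (fun ε => eLpNorm (u ε) 2 volume) l (𝓝 0) := by
  have key : Tendsto (fun ε => ∫⁻ θ, ‖u ε θ‖ₑ ^ (2 : ℝ)) l (𝓝 (∫⁻ _ : ℝ, 0)) := by
    refine tendsto_lintegral_filter_of_dominated_convergence' (fun θ => ‖H θ‖ₑ ^ (2 : ℝ)) ?_ ?_ ?_ ?_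
    · filter_upwards [hm] with ε h
      exact h.enorm.pow_const _
    · filter_upwards [hb] with ε h
      filter_upwards [h] with θ h
      gcongr
      exact enorm_le_iff_norm_le.2 (h.trans (le_abs_self _))
    · have := lintegral_rpow_enorm_lt_top_of_eLpNorm_lt_top (p := 2) (by norm_num) (by norm_num) hH.2
      simpa using! this.ne
    · filter_upwards [hlim] with θ h
      have h2 := (ENNReal.continuous_rpow_const (y := 2)).continuousAt.tendsto.comp h.enorm
      simpa [Function.comp_def] using h2
  rw [lintegral_zero] at key
  have h3 := (ENNReal.continuous_rpow_const (y := 1 / 2)).continuousAt.tendsto.comp key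
  simp only [eLpNorm_eq_lintegral_rpow_enorm_toReal (p := 2) (by norm_num) (by norm_num)]
  simpa [Function.comp_def] using h3

theorem eLpNorm_one_mul_le {a b : ℝ → ℂ} (ha : AEStronglyMeasurable a volume)
    (hb : AEStronglyMeasurable b volume) :
    eLpNorm (fun θ => a θ * b θ) 1 volume ≤ eLpNorm a 2 volume * eLpNorm b 2 volume := by
  have h : eLpNorm (a • b) 1 volume ≤ eLpNorm a 2 volume * eLpNorm b 2 volume :=
    eLpNorm_smul_le_mul_eLpNorm hb ha
  exact h

/-- The bilinear pairing is jointly continuous for `L²`-convergence. -/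
theorem tendsto_integral_mul {a b : ℝ → ℝ → ℂ} {u v : ℝ → ℂ} {l : Filter ℝ}
    (ha : ∀ᶠ ε in l, MemLp (a ε) 2 volume) (hb : ∀ᶠ ε in l, MemLp (b ε) 2 volume)
    (hu : MemLp u 2 volume) (hv : MemLp v 2 volume)
    (hau : Tendsto (fun ε => eLpNorm (fun θ => a ε θ - u θ) 2 volume) l (𝓝 0))
    (hbv : Tendsto (fun ε => eLpNorm (fun θ => b ε θ - v θ) 2 volume) l (𝓝 0)) :
    Tendsto (fun ε => ∫ θ, a ε θ * b ε θ) l (𝓝 (∫ θ, u θ * v θ)) := by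
  refine tendsto_integral_of_L1' (F := fun ε θ => a ε θ * b ε θ) (fun θ => u θ * v θ)
    (hu.integrable_mul hv).1 ?_ ?_
  · filter_upwards [ha, hb] with ε h1 h2
    exact h1.integrable_mul h2
  · have h1 := ENNReal.Tendsto.mul hau (Or.inr ENNReal.zero_ne_top) hbv
      (Or.inr ENNReal.zero_ne_top)
    have h2 := ENNReal.Tendsto.mul_const (b := eLpNorm v 2 volume) hau (Or.inr hv.2.ne)
    have h3 := ENNReal.Tendsto.const_mul (a := eLpNorm u 2 volume) hbv (Or.inr hu.2.ne)
    have h4 := (h1.add h2).add h3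
    simp only [zero_mul, mul_zero, add_zero] at h4
    refine tendsto_of_tendsto_of_tendsto_of_le_of_le' tendsto_const_nhds h4
      (Eventually.of_forall fun _ => zero_le) ?_
    filter_upwards [ha, hb] with ε h1 h2
    have m1 := h1.1.sub hu.1
    have m2 := h2.1.sub hv.1
    calc eLpNorm ((fun θ => a ε θ * b ε θ) - fun θ => u θ * v θ) 1 volume
        = eLpNorm ((fun θ => (a ε θ - u θ) * (b ε θ - v θ)) + (fun θ => (a ε θ - u θ) * v θ)
            + fun θ => u θ * (b ε θ - v θ)) 1 volume := by
          congr 1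
          ext θ
          simp only [Pi.sub_apply, Pi.add_apply]
          ring
      _ ≤ _ := by
          refine (eLpNorm_add_le ((m1.mul m2).add (m1.mul hv.1)) (hu.1.mul m2) le_rfl).trans ?_
          refine add_le_add ((eLpNorm_add_le (m1.mul m2) (m1.mul hv.1) le_rfl).trans ?_) ?_
          · exact add_le_add (eLpNorm_one_mul_le m1 m2) (eLpNorm_one_mul_le m1 hv.1)
          · exact eLpNorm_one_mul_le hu.1 m2

/-! ### Cauchy's theorem on the strip and its boundary. -/

/-- An integrable function cannot stay above a positive constant on a half-line. This disposes of
the vertical sides of long rectangles without any pointwise decay of the integrand. -/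
theorem eq_zero_of_tendsto_of_le_integrable {D : ℝ → ℂ} {s : ℝ → ℝ} {L : ℂ}
    (hD : Tendsto D atTop (𝓝 L)) (hs : Integrable s) (hle : ∀ T, ‖D T‖ ≤ s T) : L = 0 := by
  by_contra hL
  have hpos : 0 < ‖L‖ / 2 := by positivity
  have h1 : ∀ᶠ T in atTop, ‖L‖ / 2 < ‖D T‖ := hD.norm.eventually (lt_mem_nhds (by linarith))
  obtain ⟨T₀, hT₀⟩ := eventually_atTop.1 h1
  have h2 : IntegrableOn (fun _ : ℝ => ‖L‖ / 2) (Set.Ioi T₀) := by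
    refine (hs.integrableOn (s := Set.Ioi T₀)).mono' aestronglyMeasurable_const ?_
    refine (ae_restrict_iff' measurableSet_Ioi).2 (Eventually.of_forall fun T hT => ?_)
    rw [Real.norm_of_nonneg hpos.le]
    exact (hT₀ T (le_of_lt hT)).le.trans (hle T)
  rw [integrableOn_const_iff] at h2
  simp [hpos.ne'] at h2

theorem isOpen_strip : IsOpen strip :=
  (isOpen_lt continuous_const Complex.continuous_im).inter
    (isOpen_lt Complex.continuous_im continuous_const)

theorem strip_mem {y : ℝ} (h1 : -Real.pi < y) (h2 : y < 0) (θ : ℝ) :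
    (θ + y * Complex.I : ℂ) ∈ strip := by
  simp [strip, h1, h2]

/-- Cauchy's theorem on the strip: if `P` is analytic and uniformly integrable on horizontal lines,
its integral along horizontal lines does not depend on the line. -/
theorem integral_line_eq {P : ℂ → ℂ} (hP : DifferentiableOn ℂ P strip) {C : ℝ}
    (hint : ∀ y : ℝ, -Real.pi < y → y < 0 → Integrable fun θ : ℝ => P (θ + y * Complex.I))
    (hC : ∀ y : ℝ, -Real.pi < y → y < 0 → ∫ θ : ℝ, ‖P (θ + y * Complex.I)‖ ≤ C)
    {y₁ y₂ : ℝ} (h1 : -Real.pi < y₁) (h12 : y₁ ≤ y₂) (h2 : y₂ < 0) :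
    ∫ θ : ℝ, P (θ + y₁ * Complex.I) = ∫ θ : ℝ, P (θ + y₂ * Complex.I) := by
  have hcont : ContinuousOn (fun p : ℝ × ℝ => P (p.1 + p.2 * Complex.I))
      (Set.univ ×ˢ Set.Icc y₁ y₂) := by
    refine hP.continuousOn.comp (by fun_prop) fun p hp => ?_
    exact strip_mem (h1.trans_le hp.2.1) (hp.2.2.trans_lt h2) _
  set ν := (volume : Measure ℝ).restrict (Set.Icc y₁ y₂) with hν
  have hmeas : AEStronglyMeasurable (fun p : ℝ × ℝ => P (p.1 + p.2 * Complex.I))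
      ((volume : Measure ℝ).prod ν) := by
    have := hcont.aestronglyMeasurable (μ := (volume : Measure ℝ).prod volume)
      (MeasurableSet.univ.prod measurableSet_Icc)
    rwa [← Measure.prod_restrict, Measure.restrict_univ] at this
  have hprod : Integrable (fun p : ℝ × ℝ => P (p.1 + p.2 * Complex.I))
      ((volume : Measure ℝ).prod ν) := by
    rw [integrable_prod_iff' hmeas]
    constructor
    · refine (ae_restrict_iff' measurableSet_Icc).2 (Eventually.of_forall fun y hy => ?_)
      exact hint y (h1.trans_le hy.1) (hy.2.trans_lt h2)
    · refine Integrable.mono' (g := fun _ => C) (integrable_const C) ?_ ?_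
      · exact hmeas.norm.prod_swap.integral_prod_right'
      · refine (ae_restrict_iff' measurableSet_Icc).2 (Eventually.of_forall fun y hy => ?_)
        rw [Real.norm_of_nonneg (integral_nonneg fun _ => norm_nonneg _)]
        exact hC y (h1.trans_le hy.1) (hy.2.trans_lt h2)
  -- By Fubini, the integral of |P| over the vertical segment at abscissa x is integrable in x;
  -- adding its mirror image controls the sides at T and -T together.
  have hs := hprod.norm.integral_prod_left
  have hs2 := hs.add hs.comp_neg
  have hD : Tendsto (fun T : ℝ => (∫ θ in (-T)..T, P (θ + y₁ * Complex.I)) -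
      ∫ θ in (-T)..T, P (θ + y₂ * Complex.I)) atTop
      (𝓝 ((∫ θ : ℝ, P (θ + y₁ * Complex.I)) - ∫ θ : ℝ, P (θ + y₂ * Complex.I))) :=
    (intervalIntegral_tendsto_integral (hint y₁ h1 (h12.trans_lt h2)) tendsto_neg_atTop_atBot
      tendsto_id).sub
    (intervalIntegral_tendsto_integral (hint y₂ (h1.trans_le h12) h2) tendsto_neg_atTop_atBot
      tendsto_id)
  refine sub_eq_zero.1 (eq_zero_of_tendsto_of_le_integrable hD hs2 fun T => ?_)
  have hrect := Complex.integral_boundary_rect_eq_zero_of_differentiableOn P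
    (⟨-T, y₁⟩ : ℂ) (⟨T, y₂⟩ : ℂ) (hP.mono ?_)
  · simp only at hrect
    have hside : ∀ x : ℝ, ‖∫ y in y₁..y₂, P (x + y * Complex.I)‖ ≤
        ∫ y, ‖P (x + y * Complex.I)‖ ∂ν := fun x => by
      rw [intervalIntegral.integral_of_le h12, ← integral_Icc_eq_integral_Ioc]
      exact norm_integral_le_integral_norm _
    have e : (∫ θ in (-T)..T, P (θ + y₁ * Complex.I)) - ∫ θ in (-T)..T, P (θ + y₂ * Complex.I) =
        Complex.I • (∫ y in y₁..y₂, P ((-T : ℝ) + y * Complex.I)) -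
        Complex.I • (∫ y in y₁..y₂, P ((T : ℝ) + y * Complex.I)) := by
      linear_combination hrect
    rw [e]
    refine (norm_sub_le _ _).trans ?_
    rw [norm_smul, norm_smul, Complex.norm_I, one_mul, one_mul, add_comm]
    exact add_le_add (hside T) (hside (-T))
  · intro z hz
    have hz2 := hz.2
    simp only [Set.mem_preimage, Set.uIcc_of_le h12] at hz2
    exact ⟨h1.trans_le hz2.1, hz2.2.trans_lt h2⟩

theorem MemHardy.memLp {F : ℂ → ℂ} (hF : MemHardy F) {y : ℝ} (h1 : -Real.pi < y) (h2 : y < 0) :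
    MemLp (fun θ : ℝ => F (θ + y * Complex.I)) 2 volume := by
  obtain ⟨C, hC⟩ := hF.bounded
  exact ⟨hF.aestronglyMeasurable h1 h2, (hC y h1 h2).trans_lt ENNReal.coe_lt_top⟩

theorem MemHardy.integral_mul_line_eq {F G : ℂ → ℂ} (hF : MemHardy F) (hG : MemHardy G)
    {y₁ y₂ : ℝ} (h1 : -Real.pi < y₁) (h12 : y₁ ≤ y₂) (h2 : y₂ < 0) :
    ∫ θ : ℝ, F (θ + y₁ * Complex.I) * G (θ + y₁ * Complex.I) =
      ∫ θ : ℝ, F (θ + y₂ * Complex.I) * G (θ + y₂ * Complex.I) := by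
  obtain ⟨C, hC⟩ := hF.bounded
  obtain ⟨D, hD⟩ := hG.bounded
  have hint : ∀ y : ℝ, -Real.pi < y → y < 0 →
      Integrable fun θ : ℝ => F (θ + y * Complex.I) * G (θ + y * Complex.I) :=
    fun y h1 h2 => (hF.memLp h1 h2).integrable_mul (hG.memLp h1 h2)
  refine integral_line_eq (P := fun ζ => F ζ * G ζ) (C := C * D) (hF.analytic.mul hG.analytic)
    hint (fun y h1 h2 => ?_) h1 h12 h2
  rw [integral_norm_eq_lintegral_enorm (hint y h1 h2).1, ← eLpNorm_one_eq_lintegral_enorm]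
  refine ENNReal.toReal_le_of_le_ofReal (by positivity) ?_
  rw [ENNReal.ofReal_mul (by positivity), ENNReal.ofReal_coe_nnreal, ENNReal.ofReal_coe_nnreal]
  exact (eLpNorm_one_mul_le (hF.memLp h1 h2).1 (hG.memLp h1 h2).1).trans
    (mul_le_mul' (hC y h1 h2) (hD y h1 h2))

/-- `F` is in the Hardy space, with upper and lower boundary values `ξ` and `η`. -/
structure HasBoundaryValues (F : ℂ → ℂ) (ξ η : L2) : Prop where
  memHardy : MemHardy F
  upper : IsUpperBoundaryValue F ξ
  lower : IsLowerBoundaryValue F η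

theorem mem_continuationGraph {ξ η : L2} :
    (ξ, η) ∈ continuationGraph ↔ ∃ F, HasBoundaryValues F ξ η :=
  ⟨fun ⟨F, h1, h2, h3⟩ => ⟨F, h1, h2, h3⟩, fun ⟨F, h⟩ => ⟨F, h.1, h.2, h.3⟩⟩

theorem MemHardy.memLp_upper {F : ℂ → ℂ} (hF : MemHardy F) :
    ∀ᶠ ε : ℝ in 𝓝[>] 0, MemLp (fun θ : ℝ => F (θ - ε * Complex.I)) 2 volume := by
  filter_upwards [Ioo_mem_nhdsGT Real.pi_pos] with ε hε
  convert hF.memLp (y := -ε) (by linarith [hε.2]) (by linarith [hε.1]) using 4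
  push_cast
  ring

theorem MemHardy.memLp_lower {F : ℂ → ℂ} (hF : MemHardy F) :
    ∀ᶠ ε : ℝ in 𝓝[>] 0, MemLp (fun θ : ℝ => F (θ - (Real.pi - ε) * Complex.I)) 2 volume := by
  filter_upwards [Ioo_mem_nhdsGT Real.pi_pos] with ε hε
  convert hF.memLp (y := ε - Real.pi) (by linarith [hε.1]) (by linarith [hε.2]) using 4
  push_cast
  ring

/-- Cauchy's theorem for a product of two Hardy functions, on the boundary of the strip. -/
theorem HasBoundaryValues.integral_mul_eq {F G : ℂ → ℂ} {ξ η ξ' η' : L2}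
    (hF : HasBoundaryValues F ξ η) (hG : HasBoundaryValues G ξ' η') :
    ∫ θ, ξ θ * ξ' θ = ∫ θ, η θ * η' θ := by
  have t1 := tendsto_integral_mul hF.memHardy.memLp_upper hG.memHardy.memLp_upper
    (Lp.memLp ξ) (Lp.memLp ξ') hF.upper hG.upper
  have t2 := tendsto_integral_mul hF.memHardy.memLp_lower hG.memHardy.memLp_lower
    (Lp.memLp η) (Lp.memLp η') hF.lower hG.lower
  refine tendsto_nhds_unique t1 (t2.congr' ?_)
  -- For ε < π/2 the line at height ε - π lies below the one at height -ε, as the comparison of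
  -- lines requires.
  filter_upwards [Ioo_mem_nhdsGT (half_pos Real.pi_pos)] with ε hε
  have := hF.memHardy.integral_mul_line_eq hG.memHardy (y₁ := ε - Real.pi) (y₂ := -ε)
    (by linarith [hε.1]) (by linarith [hε.2]) (by linarith [hε.1])
  convert this using 5 <;> push_cast <;> ring_nf

/-! ### Fourier uniqueness and totality of modulations. -/

/-- Injectivity of the Fourier transform on `L¹(ℝ)`. -/
theorem ae_eq_zero_of_integral_exp_mul_eq_zero {h : ℝ → ℂ} (hh : Integrable h)
    (h0 : ∀ p : ℝ, ∫ θ : ℝ, Complex.exp (Complex.I * p * θ) * h θ = 0) : h =ᵐ[volume] 0 := by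
  have hF : FourierTransform.fourier h = 0 := by
    ext w
    rw [Real.fourier_real_eq_integral_exp_smul, Pi.zero_apply, ← h0 (-2 * Real.pi * w)]
    congr 1 with θ
    rw [smul_eq_mul]
    congr 2
    push_cast
    ring
  -- Every test function g is the Fourier transform of a Schwartz function ψ, so ∫ g h = ∫ ψ ĥ = 0.
  refine ae_eq_zero_of_integral_contDiff_smul_eq_zero hh.locallyIntegrable fun g hg hgc => ?_
  have hg₁ : HasCompactSupport (Complex.ofRealCLM ∘ g) := hgc.comp_left rfl
  have hg₂ : ContDiff ℝ ∞ (Complex.ofRealCLM ∘ g) := by fun_prop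
  set φ : SchwartzMap ℝ ℂ := hg₁.toSchwartzMap hg₂ with hφ
  set ψ : SchwartzMap ℝ ℂ := FourierTransformInv.fourierInv φ with hψ
  have e : FourierTransform.fourier (ψ : ℝ → ℂ) = φ := by
    rw [← SchwartzMap.fourier_coe, hψ, FourierTransform.fourier_fourierInv_eq]
  have key : ∫ ξ, FourierTransform.fourier (ψ : ℝ → ℂ) ξ • h ξ =
      ∫ x, ψ x • FourierTransform.fourier h x := by
    simpa using! (VectorFourier.integral_fourierIntegral_smul_eq_flip (L := innerₗ ℝ)
      Real.continuous_fourierChar continuous_inner ψ.integrable hh)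
  rw [e, hF] at key
  simpa [hφ] using key

/-- A square integrable function orthogonal to all modulations of a nowhere vanishing square
integrable function vanishes. -/
theorem ae_eq_zero_of_integral_modulation {v w : ℝ → ℂ} (hv : MemLp v 2 volume)
    (hw : MemLp w 2 volume) (hw0 : ∀ θ, w θ ≠ 0)
    (h : ∀ p : ℝ, ∫ θ : ℝ, v θ * (w θ * Complex.exp (Complex.I * p * θ)) = 0) :
    v =ᵐ[volume] 0 := by
  have := ae_eq_zero_of_integral_exp_mul_eq_zero (h := fun θ => v θ * w θ)
    (hv.integrable_mul hw) fun p => by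
      rw [← h p]
      congr 1 with θ
      ring
  filter_upwards [this] with θ hθ
  exact (mul_eq_zero.1 hθ).resolve_right (hw0 θ)

/-! ### Entire functions with a square integrable majorant on the strip. -/

theorem continuous_line {F : ℂ → ℂ} (hF : Differentiable ℂ F) (y : ℝ) :
    Continuous fun θ : ℝ => F (θ + y * Complex.I) :=
  hF.continuous.comp (by fun_prop)

section Dominated

variable {F : ℂ → ℂ} {H : ℝ → ℝ}

theorem memLp_line_of_dominated (hF : Differentiable ℂ F) (hH : MemLp H 2 volume)
    (hb : ∀ θ y : ℝ, -Real.pi ≤ y → y ≤ 0 → ‖F (θ + y * Complex.I)‖ ≤ H θ)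
    {y : ℝ} (h1 : -Real.pi ≤ y) (h2 : y ≤ 0) :
    MemLp (fun θ : ℝ => F (θ + y * Complex.I)) 2 volume :=
  hH.mono' (continuous_line hF y).aestronglyMeasurable (Eventually.of_forall fun θ => hb θ y h1 h2)

theorem memHardy_of_dominated (hF : Differentiable ℂ F) (hH : MemLp H 2 volume)
    (hb : ∀ θ y : ℝ, -Real.pi ≤ y → y ≤ 0 → ‖F (θ + y * Complex.I)‖ ≤ H θ) : MemHardy F := by
  refine ⟨hF.differentiableOn, (eLpNorm H 2 volume).toNNReal, fun y h1 h2 => ?_⟩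
  rw [ENNReal.coe_toNNReal hH.2.ne]
  exact eLpNorm_mono_real (hb · y h1.le h2.le)

theorem tendsto_line_of_dominated (hF : Differentiable ℂ F) (hH : MemLp H 2 volume)
    (hb : ∀ θ y : ℝ, -Real.pi ≤ y → y ≤ 0 → ‖F (θ + y * Complex.I)‖ ≤ H θ)
    {y : ℝ → ℝ} {y₀ : ℝ} {l : Filter ℝ} [l.IsCountablyGenerated] (hy : Tendsto y l (𝓝 y₀))
    (hy1 : ∀ᶠ ε in l, -Real.pi ≤ y ε ∧ y ε ≤ 0) (h1 : -Real.pi ≤ y₀) (h2 : y₀ ≤ 0) :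
    Tendsto (fun ε => eLpNorm (fun θ : ℝ => F (θ + y ε * Complex.I) - F (θ + y₀ * Complex.I))
      2 volume) l (𝓝 0) := by
  refine tendsto_eLpNorm_two_zero (H := fun θ => H θ + H θ) (hH.add hH)
    (Eventually.of_forall fun ε =>
      ((continuous_line hF _).sub (continuous_line hF _)).aestronglyMeasurable) ?_ ?_
  · filter_upwards [hy1] with ε hε
    exact Eventually.of_forall fun θ =>
      (norm_sub_le _ _).trans (add_le_add (hb _ _ hε.1 hε.2) (hb _ _ h1 h2))
  · refine Eventually.of_forall fun θ => ?_
    have hc : Continuous fun y : ℝ => F (θ + y * Complex.I) := hF.continuous.comp (by fun_prop)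
    have := ((hc.tendsto y₀).comp hy).sub_const (F (θ + y₀ * Complex.I))
    rwa [sub_self] at this

/-- An entire function dominated on the closed strip by a square integrable function of the real
part lies in the Hardy space, its boundary values being its restrictions. -/
theorem hasBoundaryValues_of_dominated (hF : Differentiable ℂ F) (hH : MemLp H 2 volume)
    (hb : ∀ θ y : ℝ, -Real.pi ≤ y → y ≤ 0 → ‖F (θ + y * Complex.I)‖ ≤ H θ) {ξ η : L2}
    (hξ : ξ =ᵐ[volume] fun θ : ℝ => F θ) (hη : η =ᵐ[volume] fun θ : ℝ => F (θ - Real.pi * Complex.I)) :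
    HasBoundaryValues F ξ η := by
  refine ⟨memHardy_of_dominated hF hH hb, ?_, ?_⟩
  · have hlim : Tendsto (fun ε : ℝ => -ε) (𝓝[>] 0) (𝓝 0) := by
      have : Tendsto (fun ε : ℝ => -ε) (𝓝 0) (𝓝 (-0)) := continuous_neg.tendsto 0
      rw [neg_zero] at this
      exact this.mono_left nhdsWithin_le_nhds
    refine (tendsto_line_of_dominated hF hH hb hlim ?_ (by linarith [Real.pi_pos]) le_rfl).congr
      fun ε => ?_
    · filter_upwards [Ioo_mem_nhdsGT Real.pi_pos] with ε hε
      constructor <;> linarith [hε.1, hε.2]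
    · apply eLpNorm_congr_ae
      filter_upwards [hξ] with θ hθ
      rw [hθ]
      congr 2
      · push_cast; ring
      · push_cast; ring
  · have hlim : Tendsto (fun ε : ℝ => ε - Real.pi) (𝓝[>] 0) (𝓝 (-Real.pi)) := by
      have : Tendsto (fun ε : ℝ => ε - Real.pi) (𝓝 0) (𝓝 (0 - Real.pi)) :=
        (continuous_id.sub continuous_const).tendsto 0
      rw [zero_sub] at this
      exact this.mono_left nhdsWithin_le_nhds
    refine (tendsto_line_of_dominated hF hH hb hlim ?_ le_rfl (by linarith [Real.pi_pos])).congr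
      fun ε => ?_
    · filter_upwards [Ioo_mem_nhdsGT Real.pi_pos] with ε hε
      constructor <;> linarith [hε.1, hε.2]
    · apply eLpNorm_congr_ae
      filter_upwards [hη] with θ hθ
      rw [hθ]
      congr 2
      · push_cast; ring
      · push_cast; ring

theorem exists_hasBoundaryValues_of_dominated (hF : Differentiable ℂ F) (hH : MemLp H 2 volume)
    (hb : ∀ θ y : ℝ, -Real.pi ≤ y → y ≤ 0 → ‖F (θ + y * Complex.I)‖ ≤ H θ) :
    ∃ ξ η : L2, HasBoundaryValues F ξ η ∧ (ξ =ᵐ[volume] fun θ : ℝ => F θ) ∧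
      (η =ᵐ[volume] fun θ : ℝ => F (θ - Real.pi * Complex.I)) := by
  have h0 : MemLp (fun θ : ℝ => F θ) 2 volume := by
    simpa using memLp_line_of_dominated hF hH hb (by linarith [Real.pi_pos]) le_rfl
  have h1 : MemLp (fun θ : ℝ => F (θ - Real.pi * Complex.I)) 2 volume := by
    simpa [sub_eq_add_neg] using memLp_line_of_dominated hF hH hb le_rfl (by linarith [Real.pi_pos])
  exact ⟨h0.toLp, h1.toLp, hasBoundaryValues_of_dominated hF hH hb h0.coeFn_toLp h1.coeFn_toLp,
    h0.coeFn_toLp, h1.coeFn_toLp⟩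

end Dominated

/-! ### Gaussian modes and uniqueness of the continuation. -/

/-- The modulated Gaussian `exp(-ζ² + ipζ)`. -/
def gaussianMode (p : ℝ) (ζ : ℂ) : ℂ := Complex.exp (-ζ ^ 2) * Complex.exp (Complex.I * p * ζ)

theorem differentiable_gaussianMode (p : ℝ) : Differentiable ℂ (gaussianMode p) := by
  unfold gaussianMode
  fun_prop

theorem memLp_exp_neg_sq : MemLp (fun θ : ℝ => Real.exp (-θ ^ 2)) 2 volume := by
  rw [memLp_two_iff_integrable_sq (Continuous.aestronglyMeasurable (by fun_prop))]
  refine (integrable_exp_neg_mul_sq (b := 2) (by norm_num)).congr (Eventually.of_forall fun θ => ?_)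
  simp only [← Real.exp_nat_mul]
  congr 1
  push_cast
  ring

theorem norm_gaussianMode_le (p θ y : ℝ) (h1 : -Real.pi ≤ y) (h2 : y ≤ 0) :
    ‖gaussianMode p (θ + y * Complex.I)‖ ≤
      Real.exp (Real.pi ^ 2 + |p| * Real.pi) * Real.exp (-θ ^ 2) := by
  have e1 : (-((θ : ℂ) + y * Complex.I) ^ 2).re = y ^ 2 - θ ^ 2 := by
    simp [sq]
  have e2 : (Complex.I * p * ((θ : ℂ) + y * Complex.I)).re = -(p * y) := by
    simp
  rw [gaussianMode, norm_mul, Complex.norm_exp, Complex.norm_exp, e1, e2, ← Real.exp_add,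
    ← Real.exp_add, Real.exp_le_exp]
  have h3 : -(p * y) ≤ |p| * Real.pi := by
    calc -(p * y) ≤ |p * y| := neg_le_abs _
      _ = |p| * |y| := abs_mul _ _
      _ ≤ |p| * Real.pi := by
        gcongr
        exact abs_le.2 ⟨h1, by linarith [Real.pi_pos]⟩
  nlinarith

theorem exists_hasBoundaryValues_gaussianMode (p : ℝ) :
    ∃ ξ η : L2, HasBoundaryValues (gaussianMode p) ξ η ∧
      (ξ =ᵐ[volume] fun θ : ℝ => gaussianMode p θ) ∧
      (η =ᵐ[volume] fun θ : ℝ => gaussianMode p (θ - Real.pi * Complex.I)) :=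
  exists_hasBoundaryValues_of_dominated (differentiable_gaussianMode p)
    (memLp_exp_neg_sq.const_mul _) (norm_gaussianMode_le p)

/-- A Hardy function with vanishing upper boundary value has vanishing lower boundary value. -/
theorem HasBoundaryValues.lower_eq_zero {F : ℂ → ℂ} {η : L2} (hF : HasBoundaryValues F 0 η) :
    η = 0 := by
  have hw : MemLp (fun θ : ℝ => Complex.exp (-((θ : ℂ) - Real.pi * Complex.I) ^ 2)) 2 volume := by
    have := memLp_line_of_dominated (differentiable_gaussianMode 0)
      (memLp_exp_neg_sq.const_mul _) (norm_gaussianMode_le 0) le_rfl (by linarith [Real.pi_pos])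
    simpa [gaussianMode, sub_eq_add_neg] using this
  refine (Lp.eq_zero_iff_ae_eq_zero).2 (ae_eq_zero_of_integral_modulation (Lp.memLp η) hw
    (fun θ => Complex.exp_ne_zero _) fun p => ?_)
  obtain ⟨ξ', η', hG, -, h1⟩ := exists_hasBoundaryValues_gaussianMode p
  have h := hF.integral_mul_eq hG
  have hz : ∫ θ, (0 : L2) θ * ξ' θ = 0 := by simp
  -- Shifting by -πi only multiplies the modulation by a nonzero constant, so the lower values of
  -- the modes are again, up to scalars, all modulations of one nowhere vanishing function.
  have hc : ∫ θ, η θ * η' θ = Complex.exp (Complex.I * p * (-(Real.pi * Complex.I))) *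
      ∫ θ : ℝ, η θ * (Complex.exp (-((θ : ℂ) - Real.pi * Complex.I) ^ 2) *
        Complex.exp (Complex.I * p * θ)) := by
    rw [← integral_const_mul]
    apply integral_congr_ae
    filter_upwards [h1] with θ hθ
    have : Complex.exp (Complex.I * p * (θ - Real.pi * Complex.I)) =
        Complex.exp (Complex.I * p * (-(Real.pi * Complex.I))) * Complex.exp (Complex.I * p * θ) := by
      rw [← Complex.exp_add]
      congr 1
      ring
    rw [hθ, gaussianMode, this]
    ring
  rw [hz, hc] at h
  exact (mul_eq_zero.1 h.symm).resolve_left (Complex.exp_ne_zero _)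

/-! ### Reflection and bounded analytic multipliers. -/

/-- `F^♯(ζ) = conj F(conj ζ - πi)`. -/
def reflection (F : ℂ → ℂ) (ζ : ℂ) : ℂ :=
  (starRingEnd ℂ) (F ((starRingEnd ℂ) ζ - Real.pi * Complex.I))

theorem reflection_line (F : ℂ → ℂ) (θ y : ℝ) :
    reflection F (θ + y * Complex.I) = (starRingEnd ℂ) (F (θ + (-y - Real.pi : ℝ) * Complex.I)) := by
  rw [reflection]
  congr 2
  simp
  ring

/-- Reflection exchanges and conjugates the boundary values. -/
theorem HasBoundaryValues.reflection {F : ℂ → ℂ} {ξ η : L2} (hF : HasBoundaryValues F ξ η) :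
    HasBoundaryValues (reflection F) (star η) (star ξ) := by
  refine ⟨⟨fun ζ hζ => ?_, ?_⟩, ?_, ?_⟩
  · have hmem : (starRingEnd ℂ) ζ - Real.pi * Complex.I ∈ strip := by
      have h := hζ
      simp only [strip, Set.mem_ofPred_eq] at h
      simp [strip]
      constructor <;> linarith [h.1, h.2]
    have hd : DifferentiableAt ℂ (fun w => F (w - Real.pi * Complex.I)) ((starRingEnd ℂ) ζ) :=
      (hF.memHardy.analytic.differentiableAt (isOpen_strip.mem_nhds hmem)).comp
        ((starRingEnd ℂ) ζ) (by fun_prop)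
    have := hd.conj_conj
    rw [Complex.conj_conj] at this
    exact this.differentiableWithinAt
  · obtain ⟨C, hC⟩ := hF.memHardy.bounded
    refine ⟨C, fun y h1 h2 => ?_⟩
    simp only [reflection_line]
    refine le_trans (le_of_eq ?_) (hC (-y - Real.pi) (by linarith) (by linarith))
    exact eLpNorm_conj _ _ _
  · refine hF.lower.congr fun ε => ?_
    rw [← eLpNorm_conj]
    apply eLpNorm_congr_ae
    filter_upwards [Lp.coeFn_star η] with θ hθ
    have := reflection_line F θ (-ε)
    have e1 : (θ : ℂ) + (-ε : ℝ) * Complex.I = θ - ε * Complex.I := by push_cast; ring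
    have e2 : (θ : ℂ) + (- -ε - Real.pi : ℝ) * Complex.I = θ - (Real.pi - ε) * Complex.I := by
      push_cast; ring
    rw [e1, e2] at this
    rw [this, hθ]
    simp
  · refine hF.upper.congr fun ε => ?_
    rw [← eLpNorm_conj]
    apply eLpNorm_congr_ae
    filter_upwards [Lp.coeFn_star ξ] with θ hθ
    have := reflection_line F θ (ε - Real.pi)
    have e1 : (θ : ℂ) + (ε - Real.pi : ℝ) * Complex.I = θ - (Real.pi - ε) * Complex.I := by
      push_cast; ring
    have e2 : (θ : ℂ) + (-(ε - Real.pi) - Real.pi : ℝ) * Complex.I = θ - ε * Complex.I := by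
      push_cast; ring
    rw [e1, e2] at this
    rw [this, hθ]
    simp

/-- Bounded pointwise convergent multipliers preserve `L²`-convergence. -/
theorem tendsto_eLpNorm_mul_of_bounded {m u : ℝ → ℝ → ℂ} {m₀ : ℝ → ℂ} {ξ ξ' : L2} {l : Filter ℝ}
    [l.IsCountablyGenerated]
    (hm : ∀ ε, Continuous (m ε)) (hm₀ : Continuous m₀)
    (hb : ∀ᶠ ε in l, ∀ θ, ‖m ε θ‖ ≤ 1) (hb₀ : ∀ θ, ‖m₀ θ‖ ≤ 1)
    (hlim : ∀ θ, Tendsto (fun ε => m ε θ) l (𝓝 (m₀ θ)))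
    (hu : ∀ᶠ ε in l, AEStronglyMeasurable (u ε) volume)
    (hξ : Tendsto (fun ε => eLpNorm (fun θ => u ε θ - ξ θ) 2 volume) l (𝓝 0))
    (hξ' : ξ' =ᵐ[volume] fun θ => m₀ θ * ξ θ) :
    Tendsto (fun ε => eLpNorm (fun θ => m ε θ * u ε θ - ξ' θ) 2 volume) l (𝓝 0) := by
  have hξm := Lp.aestronglyMeasurable ξ
  have h2 : Tendsto (fun ε => eLpNorm (fun θ => (m ε θ - m₀ θ) * ξ θ) 2 volume) l (𝓝 0) := by
    refine tendsto_eLpNorm_two_zero (H := fun θ => 2 * ‖ξ θ‖) ((Lp.memLp ξ).norm.const_mul 2)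
      (Eventually.of_forall fun ε => ((hm ε).sub hm₀).aestronglyMeasurable.mul hξm) ?_ ?_
    · filter_upwards [hb] with ε hε
      refine Eventually.of_forall fun θ => ?_
      rw [norm_mul]
      gcongr
      exact (norm_sub_le _ _).trans (by linarith [hε θ, hb₀ θ])
    · refine Eventually.of_forall fun θ => ?_
      have := ((hlim θ).sub_const (m₀ θ)).mul_const (ξ θ)
      simpa using this
  have h3 := hξ.add h2
  rw [add_zero] at h3
  refine tendsto_of_tendsto_of_tendsto_of_le_of_le' tendsto_const_nhds h3
    (Eventually.of_forall fun _ => zero_le) ?_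
  filter_upwards [hu, hb] with ε hε hbε
  have m1 : AEStronglyMeasurable (fun θ => m ε θ * (u ε θ - ξ θ)) volume :=
    (hm ε).aestronglyMeasurable.mul (hε.sub hξm)
  have m2 : AEStronglyMeasurable (fun θ => (m ε θ - m₀ θ) * ξ θ) volume :=
    ((hm ε).sub hm₀).aestronglyMeasurable.mul hξm
  calc eLpNorm (fun θ => m ε θ * u ε θ - ξ' θ) 2 volume
      = eLpNorm ((fun θ => m ε θ * (u ε θ - ξ θ)) + fun θ => (m ε θ - m₀ θ) * ξ θ) 2 volume := by
        apply eLpNorm_congr_ae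
        filter_upwards [hξ'] with θ hθ
        simp only [hθ, Pi.add_apply]
        ring
    _ ≤ _ := by
        refine (eLpNorm_add_le m1 m2 (by norm_num)).trans (add_le_add_left ?_ _)
        refine eLpNorm_mono fun θ => ?_
        rw [norm_mul]
        exact mul_le_of_le_one_left (norm_nonneg _) (hbε θ)

/-- Multiplication by an entire function bounded by `1` on the closed strip. -/
theorem HasBoundaryValues.mul {m F : ℂ → ℂ} {ξ η ξ' η' : L2} (hm : Differentiable ℂ m)
    (hb : ∀ θ y : ℝ, -Real.pi ≤ y → y ≤ 0 → ‖m (θ + y * Complex.I)‖ ≤ 1)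
    (hF : HasBoundaryValues F ξ η) (hξ : ξ' =ᵐ[volume] fun θ : ℝ => m θ * ξ θ)
    (hη : η' =ᵐ[volume] fun θ : ℝ => m (θ - Real.pi * Complex.I) * η θ) :
    HasBoundaryValues (fun ζ => m ζ * F ζ) ξ' η' := by
  have hmc := hm.continuous
  refine ⟨⟨hm.differentiableOn.mul hF.memHardy.analytic, ?_⟩, ?_, ?_⟩
  · obtain ⟨C, hC⟩ := hF.memHardy.bounded
    refine ⟨C, fun y h1 h2 => le_trans (eLpNorm_mono fun θ => ?_) (hC y h1 h2)⟩
    rw [norm_mul]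
    exact mul_le_of_le_one_left (norm_nonneg _) (hb θ y h1.le h2.le)
  · refine tendsto_eLpNorm_mul_of_bounded (m := fun ε θ => m (θ - ε * Complex.I))
      (u := fun ε θ => F (θ - ε * Complex.I)) (m₀ := fun θ => m θ)
      (fun ε => by fun_prop) (by fun_prop) ?_ (fun θ => ?_) (fun θ => ?_) hF.memHardy.upper_meas
      hF.upper hξ
    · filter_upwards [Ioo_mem_nhdsGT Real.pi_pos] with ε hε θ
      have := hb θ (-ε) (by linarith [hε.2]) (by linarith [hε.1])
      push_cast at this
      rwa [neg_mul, ← sub_eq_add_neg] at this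
    · have := hb θ 0 (by linarith [Real.pi_pos]) le_rfl
      simpa using this
    · have hc : Continuous fun ε : ℝ => m (θ - ε * Complex.I) := by fun_prop
      have := hc.tendsto 0
      simp only [Complex.ofReal_zero, zero_mul, sub_zero] at this
      exact this.mono_left nhdsWithin_le_nhds
  · refine tendsto_eLpNorm_mul_of_bounded (m := fun ε θ => m (θ - (Real.pi - ε) * Complex.I))
      (u := fun ε θ => F (θ - (Real.pi - ε) * Complex.I))
      (m₀ := fun θ => m (θ - Real.pi * Complex.I))
      (fun ε => by fun_prop) (by fun_prop) ?_ (fun θ => ?_) (fun θ => ?_) hF.memHardy.lower_meas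
      hF.lower hη
    · filter_upwards [Ioo_mem_nhdsGT Real.pi_pos] with ε hε θ
      have := hb θ (-(Real.pi - ε)) (by linarith [hε.1]) (by linarith [hε.2])
      push_cast at this
      rwa [neg_mul, ← sub_eq_add_neg] at this
    · have := hb θ (-Real.pi) le_rfl (by linarith [Real.pi_pos])
      push_cast at this
      rwa [neg_mul, ← sub_eq_add_neg] at this
    · have hc : Continuous fun ε : ℝ => m (θ - (Real.pi - ε) * Complex.I) := by fun_prop
      have := hc.tendsto 0
      simp only [Complex.ofReal_zero, sub_zero] at this
      exact this.mono_left nhdsWithin_le_nhds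

/-! ### The operator: density, symmetry and eigenvectors of the adjoint. -/

/-- Without this, `Submodule.toLinearPMap` would return default values; with it, `deltaHalf` really
is analytic continuation. -/
theorem continuationGraph_single_valued :
    ∀ (x : L2 × L2) (_ : x ∈ continuationGraph) (_ : x.1 = 0), x.2 = 0 := by
  rintro ⟨ξ, η⟩ h (rfl : ξ = 0)
  obtain ⟨F, hF⟩ := mem_continuationGraph.1 h
  exact hF.lower_eq_zero

theorem mulOp_coeFn (g : Lp ℂ ∞ (volume : Measure ℝ)) (ξ : L2) :
    mulOp g ξ =ᵐ[volume] fun θ => g θ * ξ θ := by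
  have := (ContinuousLinearMap.mul ℂ ℂ).coeFn_holder (r := 2) g ξ
  simpa [mulOp] using this

section Operator

variable {α β : ℝ}

theorem boundStateOp_spec (x : (boundStateOp α β).domain) :
    ∃ (F : ℂ → ℂ) (η : L2), HasBoundaryValues F x η ∧
      boundStateOp α β x =ᵐ[volume] fun θ : ℝ => (starRingEnd ℂ) (singularInner α β θ) * η θ := by
  have h := Submodule.mem_graph_toLinearPMap continuationGraph_single_valued x
  obtain ⟨F, hF⟩ := mem_continuationGraph.1 h
  refine ⟨F, _, hF, ?_⟩
  have h2 := mulOp_coeFn (memLp_conj_singularInner α β).toLp (deltaHalf x)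
  filter_upwards [h2, (memLp_conj_singularInner α β).coeFn_toLp] with θ h3 h4
  rw [h4] at h3
  exact h3

theorem HasBoundaryValues.mem_domain {F : ℂ → ℂ} {ξ η : L2} (hF : HasBoundaryValues F ξ η) :
    ξ ∈ (boundStateOp α β).domain :=
  Submodule.mem_map.2 ⟨(ξ, η), mem_continuationGraph.2 ⟨F, hF⟩, rfl⟩

theorem inner_eq_integral (ξ η : L2) :
    inner ℂ ξ η = ∫ θ, (starRingEnd ℂ) (ξ θ) * η θ := by
  rw [L2.inner_def]
  simp only [RCLike.inner_apply, mul_comm]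

/-- The domain contains all Gaussian modes, and a vector orthogonal to them vanishes by Fourier
uniqueness. -/
theorem dense_domain_boundStateOp : Dense ((boundStateOp α β).domain : Set L2) := by
  rw [Submodule.dense_iff_topologicalClosure_eq_top, Submodule.topologicalClosure_eq_top_iff,
    Submodule.eq_bot_iff]
  intro v hv
  have hw : MemLp (fun θ : ℝ => Complex.exp (-(θ : ℂ) ^ 2)) 2 volume := by
    have := memLp_line_of_dominated (differentiable_gaussianMode 0)
      (memLp_exp_neg_sq.const_mul _) (norm_gaussianMode_le 0) (by linarith [Real.pi_pos]) le_rfl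
    simpa [gaussianMode] using this
  have h := ae_eq_zero_of_integral_modulation (Lp.memLp (star v)) hw
    (fun θ => Complex.exp_ne_zero _) fun p => ?_
  · refine Lp.eq_zero_iff_ae_eq_zero.2 ?_
    filter_upwards [h, Lp.coeFn_star v] with θ h1 h2
    rw [h1] at h2
    exact star_eq_zero.1 h2.symm
  · obtain ⟨ξ, η, hG, h0, -⟩ := exists_hasBoundaryValues_gaussianMode p
    have h1 := (Submodule.mem_orthogonal' _ _).1 hv ξ hG.mem_domain
    rw [inner_eq_integral] at h1
    rw [← h1]
    apply integral_congr_ae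
    filter_upwards [h0, Lp.coeFn_star v] with θ h2 h3
    rw [h2, h3]
    rfl

theorem differentiable_singularInner (α β : ℝ) : Differentiable ℂ (singularInner α β) := by
  unfold singularInner
  fun_prop

/-- Both atoms contribute with the sign of sin y, which is nonpositive on the strip. This gives |f|
≤ 1, and, quantitatively, the decay that compensates the growth of K. -/
theorem re_exponent (a b θ y : ℝ) :
    (Complex.I * a * Complex.exp (-(θ + y * Complex.I)) -
      Complex.I * b * Complex.exp (θ + y * Complex.I)).re =
      Real.sin y * (a * Real.exp (-θ) + b * Real.exp θ) := by
  have e : -((θ : ℂ) + y * Complex.I) = (-θ : ℝ) + (-y : ℝ) * Complex.I := by push_cast; ring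
  rw [e, Complex.exp_add_mul_I, Complex.exp_add_mul_I, ← Complex.ofReal_exp, ← Complex.ofReal_exp,
    ← Complex.ofReal_cos, ← Complex.ofReal_cos, ← Complex.ofReal_sin, ← Complex.ofReal_sin,
    Real.cos_neg, Real.sin_neg]
  generalize Real.exp (-θ) = p
  generalize Real.exp θ = q
  generalize Real.sin y = s
  generalize Real.cos y = c
  simp
  ring

theorem sin_nonpos_of_mem_strip {y : ℝ} (h1 : -Real.pi ≤ y) (h2 : y ≤ 0) : Real.sin y ≤ 0 :=
  Real.sin_nonpos_of_nonpos_of_neg_pi_le h2 h1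

theorem norm_singularInner_le (hα : 0 ≤ α) (hβ : 0 ≤ β) (θ y : ℝ) (h1 : -Real.pi ≤ y)
    (h2 : y ≤ 0) : ‖singularInner α β (θ + y * Complex.I)‖ ≤ 1 := by
  rw [singularInner, Complex.norm_exp, re_exponent, Real.exp_le_one_iff]
  exact mul_nonpos_of_nonpos_of_nonneg (sin_nonpos_of_mem_strip h1 h2) (by positivity)

theorem exp_sub_pi_mul_I (θ : ℂ) : Complex.exp (θ - Real.pi * Complex.I) = -Complex.exp θ := by
  rw [Complex.exp_sub, Complex.exp_pi_mul_I, div_neg, div_one]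

theorem exp_neg_sub_pi_mul_I (θ : ℂ) :
    Complex.exp (-(θ - Real.pi * Complex.I)) = -Complex.exp (-θ) := by
  rw [neg_sub, sub_eq_neg_add, Complex.exp_add, Complex.exp_pi_mul_I, mul_neg_one]

theorem singularInner_sub_pi_mul_I (α β θ : ℝ) :
    singularInner α β (θ - Real.pi * Complex.I) = (starRingEnd ℂ) (singularInner α β θ) := by
  rw [singularInner, singularInner, ← Complex.exp_conj, exp_sub_pi_mul_I, exp_neg_sub_pi_mul_I]
  congr 1
  simp [← Complex.exp_conj]

/-- Cauchy's theorem for F^♯ and fG: on the upper line the product is conj η · f · y, on the lower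
line conj x · f̄ · η', and these integrate to the two inner products. -/
theorem boundStateOp_isFormalAdjoint (hα : 0 ≤ α) (hβ : 0 ≤ β) :
    (boundStateOp α β).IsFormalAdjoint (boundStateOp α β) := by
  intro x y
  obtain ⟨F, η, hF, hx⟩ := boundStateOp_spec x
  obtain ⟨G, η', hG, hy⟩ := boundStateOp_spec y
  have hfm : MemLp (fun θ : ℝ => singularInner α β θ * (y : L2) θ) 2 volume := by
    refine (Lp.memLp (y : L2)).of_le (AEStronglyMeasurable.mul ?_ (Lp.aestronglyMeasurable _))
      (Eventually.of_forall fun θ => ?_)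
    · have := (differentiable_singularInner α β).continuous
      exact Continuous.aestronglyMeasurable (by fun_prop)
    · rw [norm_mul, norm_singularInner_ofReal, one_mul]
  have hfG : HasBoundaryValues (fun ζ => singularInner α β ζ * G ζ) hfm.toLp
      (boundStateOp α β y) := by
    refine hG.mul (differentiable_singularInner α β) (norm_singularInner_le hα hβ)
      hfm.coeFn_toLp ?_
    filter_upwards [hy] with θ h
    rw [h, singularInner_sub_pi_mul_I]
  have key := hF.reflection.integral_mul_eq hfG
  rw [inner_eq_integral, inner_eq_integral]
  calc ∫ θ, (starRingEnd ℂ) (boundStateOp α β x θ) * (y : L2) θ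
      = ∫ θ, (star η : L2) θ * (hfm.toLp : L2) θ := by
        apply integral_congr_ae
        filter_upwards [hx, Lp.coeFn_star η, hfm.coeFn_toLp] with θ h1 h2 h3
        rw [h1, h2, h3]
        simp
        ring
    _ = _ := by
        rw [key]
        apply integral_congr_ae
        filter_upwards [Lp.coeFn_star (x : L2)] with θ h1
        rw [h1]
        rfl

/-- `ξ` is an eigenvector of `A*` if `f ξ` extends to a Hardy function whose lower boundary value is
a multiple of `ξ`. -/
theorem mem_eigenspace_adjoint {ξ g : L2} {G : ℂ → ℂ} {z : ℂ}
    (hG : HasBoundaryValues G g (z • ξ))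
    (hg : g =ᵐ[volume] fun θ : ℝ => singularInner α β θ * ξ θ) :
    ξ ∈ eigenspace (boundStateOp α β).adjoint z := by
  have key : ∀ x : (boundStateOp α β).domain,
      inner ℂ (z • ξ) (x : L2) = inner ℂ ξ (boundStateOp α β x) := fun x => by
    -- Conjugating puts x in the antilinear slot, where F^♯ supplies its conjugate boundary values.
    rw [← inner_conj_symm, ← inner_conj_symm ξ]
    congr 1
    obtain ⟨F, η, hF, hx⟩ := boundStateOp_spec x
    have h := hF.reflection.integral_mul_eq hG
    rw [inner_eq_integral, inner_eq_integral]
    calc ∫ θ, (starRingEnd ℂ) ((x : L2) θ) * (z • ξ : L2) θ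
        = ∫ θ, (star (x : L2) : L2) θ * (z • ξ : L2) θ := by
          apply integral_congr_ae
          filter_upwards [Lp.coeFn_star (x : L2)] with θ h1
          rw [h1]
          rfl
      _ = _ := by
          rw [← h]
          apply integral_congr_ae
          filter_upwards [hx, Lp.coeFn_star η, hg] with θ h1 h2 h3
          rw [h1, h2, h3]
          simp
          ring
  have hmem : ξ ∈ (boundStateOp α β).adjoint.domain :=
    LinearPMap.mem_adjoint_domain_of_exists _ ⟨z • ξ, key⟩
  rw [eigenspace, Submodule.mem_comap, LinearPMap.mem_graph_iff]
  exact ⟨⟨ξ, hmem⟩, rfl, LinearPMap.adjoint_apply_eq dense_domain_boundStateOp ⟨ξ, hmem⟩ key⟩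

end Operator

/-! ### Paley–Wiener theory and test functions. -/

/-- The Fourier–Laplace transform `(2π)^{-1/2} ∫ e^{-itz} κ(t) dt` at a complex argument. -/
def fourierLaplace (κ : ℝ → ℝ) (z : ℂ) : ℂ :=
  (1 / Real.sqrt (2 * Real.pi) : ℝ) * ∫ t : ℝ, Complex.exp (-Complex.I * t * z) * (κ t : ℂ)

theorem fourierLaplace_ofReal (κ : ℝ → ℝ) (p : ℝ) : fourierLaplace κ p = fourierHat κ p := rfl

theorem fourierLaplace_neg {κ : ℝ → ℝ} (h : ∀ t, κ (-t) = κ t) (z : ℂ) :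
    fourierLaplace κ (-z) = fourierLaplace κ z := by
  rw [fourierLaplace, fourierLaplace, ← integral_neg_eq_self]
  congr 2 with t
  rw [h]
  congr 2
  push_cast
  ring

section Compact

variable {κ : ℝ → ℝ} {r : ℝ}

theorem norm_exp_neg_I_mul (t : ℝ) (z : ℂ) :
    ‖Complex.exp (-Complex.I * t * z)‖ = Real.exp (t * z.im) := by
  rw [Complex.norm_exp]
  congr 1
  simp

theorem hasCompactSupport_of_support_subset (hs : Function.support κ ⊆ Set.Icc (-r) r) :
    HasCompactSupport κ :=
  HasCompactSupport.of_support_subset_isCompact isCompact_Icc hs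

theorem norm_exp_mul_le (hs : Function.support κ ⊆ Set.Icc (-r) r) (t : ℝ) (z : ℂ) :
    ‖Complex.exp (-Complex.I * t * z) * (κ t : ℂ)‖ ≤ Real.exp (r * |z.im|) * |κ t| := by
  rw [norm_mul, norm_exp_neg_I_mul, Complex.norm_real, Real.norm_eq_abs]
  by_cases h : κ t = 0
  · simp [h]
  · have ht := hs h
    refine mul_le_mul_of_nonneg_right (Real.exp_le_exp.2 ?_) (abs_nonneg _)
    calc t * z.im ≤ |t * z.im| := le_abs_self _
      _ = |t| * |z.im| := abs_mul _ _
      _ ≤ r * |z.im| := by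
        gcongr
        exact abs_le.2 ht

theorem integrable_exp_mul (hκ : Continuous κ) (hs : Function.support κ ⊆ Set.Icc (-r) r) (z : ℂ) :
    Integrable fun t : ℝ => Complex.exp (-Complex.I * t * z) * (κ t : ℂ) := by
  refine (((hκ.integrable_of_hasCompactSupport
    (hasCompactSupport_of_support_subset hs)).abs).const_mul (Real.exp (r * |z.im|))).mono'
    (Continuous.aestronglyMeasurable (by fun_prop)) (Eventually.of_forall fun t => ?_)
  exact norm_exp_mul_le hs t z

theorem differentiable_fourierLaplace (hκ : Continuous κ)
    (hs : Function.support κ ⊆ Set.Icc (-r) r) : Differentiable ℂ (fourierLaplace κ) := by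
  intro z
  refine DifferentiableAt.const_mul ?_ _
  have hint := hκ.integrable_of_hasCompactSupport (μ := volume)
    (hasCompactSupport_of_support_subset hs)
  refine (hasDerivAt_integral_of_dominated_loc_of_deriv_le (μ := volume)
    (F := fun z t => Complex.exp (-Complex.I * t * z) * (κ t : ℂ))
    (F' := fun z t => (-Complex.I * t) * (Complex.exp (-Complex.I * t * z) * (κ t : ℂ)))
    (bound := fun t => (r * Real.exp (r * (|z.im| + 1))) * |κ t|)
    (Metric.ball_mem_nhds z one_pos)
    (Eventually.of_forall fun w => (integrable_exp_mul hκ hs w).1) (integrable_exp_mul hκ hs z)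
    (Continuous.aestronglyMeasurable (by fun_prop)) (Eventually.of_forall fun t w hw => ?_)
    (hint.abs.const_mul _) (Eventually.of_forall fun t w _ => ?_)).2.differentiableAt
  · by_cases h : κ t = 0
    · simp [h]
    have ht : |t| ≤ r := abs_le.2 (hs h)
    have hr : 0 ≤ r := (abs_nonneg t).trans ht
    have him : |w.im| ≤ |z.im| + 1 := by
      have h1 : |w.im - z.im| ≤ ‖w - z‖ := by simpa using Complex.abs_im_le_norm (w - z)
      have h2 : ‖w - z‖ < 1 := by simpa [dist_eq_norm] using hw
      have h3 := abs_sub_abs_le_abs_sub w.im z.im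
      linarith
    rw [norm_mul, mul_assoc r]
    refine mul_le_mul (by simpa using ht) ((norm_exp_mul_le hs t w).trans ?_) (norm_nonneg _) hr
    gcongr
  · have h1 : HasDerivAt (fun z : ℂ => -Complex.I * t * z) (-Complex.I * t) w := by
      simpa using (hasDerivAt_id w).const_mul (-Complex.I * t)
    exact (h1.cexp.mul_const (κ t : ℂ)).congr_deriv (by ring)

theorem norm_fourierLaplace_le (hκ : Continuous κ) (hs : Function.support κ ⊆ Set.Icc (-r) r) :
    ∃ C, ∀ z, ‖fourierLaplace κ z‖ ≤ C * Real.exp (r * |z.im|) := by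
  refine ⟨‖((1 / Real.sqrt (2 * Real.pi) : ℝ) : ℂ)‖ * ∫ t, |κ t|, fun z => ?_⟩
  rw [fourierLaplace, norm_mul, mul_assoc]
  gcongr
  rw [mul_comm, ← integral_const_mul]
  exact norm_integral_le_of_norm_le ((hκ.integrable_of_hasCompactSupport
    (hasCompactSupport_of_support_subset hs)).abs.const_mul _)
    (Eventually.of_forall fun t => norm_exp_mul_le hs t z)

theorem support_deriv_subset_Icc (hs : Function.support κ ⊆ Set.Icc (-r) r) :
    Function.support (deriv κ) ⊆ Set.Icc (-r) r :=
  support_deriv_subset.trans (closure_minimal hs isClosed_Icc)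

theorem fourierLaplace_deriv (hκ : ContDiff ℝ ∞ κ) (hs : Function.support κ ⊆ Set.Icc (-r) r)
    (z : ℂ) : fourierLaplace (deriv κ) z = Complex.I * z * fourierLaplace κ z := by
  have hκ' : Continuous (deriv κ) := hκ.continuous_deriv (by simp)
  have hd : ∀ t : ℝ, HasDerivAt (fun t : ℝ => Complex.exp (-Complex.I * t * z))
      ((-Complex.I * z) * Complex.exp (-Complex.I * t * z)) t := fun t => by
    have h1 : HasDerivAt (fun t : ℝ => -Complex.I * t * z) (-Complex.I * z) t := by
      simpa using ((Complex.ofRealCLM.hasDerivAt (x := t)).const_mul (-Complex.I)).mul_const z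
    exact h1.cexp.congr_deriv (by ring)
  have hk : ∀ t : ℝ, HasDerivAt (fun t => (κ t : ℂ)) ((deriv κ t : ℝ) : ℂ) t := fun t =>
    ((hκ.differentiable (by simp)) t).hasDerivAt.ofReal_comp
  have e := integral_mul_deriv_eq_deriv_mul_of_integrable (fun t _ => hd t) (fun t _ => hk t)
    (integrable_exp_mul hκ' (support_deriv_subset_Icc hs) z)
    (by
      refine ((integrable_exp_mul hκ.continuous hs z).const_mul (-Complex.I * z)).congr
        (Eventually.of_forall fun t => ?_)
      simp only [Pi.mul_apply]
      ring)
    (integrable_exp_mul hκ.continuous hs z)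
  rw [fourierLaplace, fourierLaplace, e]
  simp only [mul_assoc (-Complex.I * z)]
  rw [integral_const_mul]
  ring

/-- Paley–Wiener estimates. -/
theorem pow_mul_norm_fourierLaplace_le (N : ℕ) : ∀ {κ : ℝ → ℝ}, ContDiff ℝ ∞ κ →
    Function.support κ ⊆ Set.Icc (-r) r →
    ∃ C, ∀ z, ‖z‖ ^ N * ‖fourierLaplace κ z‖ ≤ C * Real.exp (r * |z.im|) := by
  induction N with
  | zero =>
    intro κ hκ hs
    simpa using norm_fourierLaplace_le hκ.continuous hs
  | succ N ih =>
    intro κ hκ hs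
    -- A derivative of κ gains a factor iz and keeps the support in the same interval, hence the
    -- same exponential type r.
    have hκ' : ContDiff ℝ ∞ (deriv κ) := (contDiff_infty_iff_deriv.1 hκ).2
    obtain ⟨C, hC⟩ := ih hκ' (support_deriv_subset_Icc hs)
    refine ⟨C, fun z => le_trans (le_of_eq ?_) (hC z)⟩
    rw [fourierLaplace_deriv hκ hs, norm_mul, norm_mul, Complex.norm_I, pow_succ]
    ring

theorem eq_zero_of_fourierLaplace_eq_zero (hκ : Continuous κ)
    (hs : Function.support κ ⊆ Set.Icc (-r) r) (h : fourierLaplace κ = 0) : κ = 0 := by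
  have hae := ae_eq_zero_of_integral_exp_mul_eq_zero (h := fun t => (κ t : ℂ))
    (hκ.integrable_of_hasCompactSupport (hasCompactSupport_of_support_subset hs)).ofReal fun p => by
      have h1 := congrFun h (-p)
      rw [fourierLaplace, Pi.zero_apply, mul_eq_zero] at h1
      rw [← h1.resolve_left (by norm_cast; positivity)]
      congr 1 with t
      congr 2
      ring
  have h2 : κ =ᵐ[volume] 0 := by
    filter_upwards [hae] with t ht
    exact Complex.ofReal_eq_zero.1 ht
  exact (Continuous.ae_eq_iff_eq volume hκ continuous_const).1 h2

end Compact

/-- Nonzero even smooth functions with vanishing integral exist on every interval `(-r, r)`. -/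
theorem exists_isTestFunction {r : ℝ} (hr : 0 < r) : ∃ κ, IsTestFunction r κ ∧ κ ≠ 0 := by
  let φ : ContDiffBump (0 : ℝ) := ⟨r / 2, r, by positivity, by linarith⟩
  have hφ : ContDiff ℝ ∞ φ := φ.contDiff
  -- Rescaling a bump while preserving its mass makes the difference have integral zero; its value
  -- at 0 is 1 - 2 = -1.
  refine ⟨fun t => φ t - 2 * φ (2 * t), ⟨?_, fun t ht => ?_, fun t => ?_, ?_⟩, fun h => ?_⟩
  · exact hφ.sub (contDiff_const.mul (hφ.comp (contDiff_const.mul contDiff_id)))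
  · by_contra hn
    apply ht
    have h1 : r ≤ |t| := by
      by_contra h
      exact hn (abs_lt.1 (not_le.1 h))
    have h2 : φ t = 0 := φ.zero_of_le_dist (by simpa using h1)
    have h3 : φ (2 * t) = 0 := φ.zero_of_le_dist (by
      simp only [dist_zero_right, Real.norm_eq_abs, abs_mul, abs_two]
      change r ≤ 2 * |t|
      linarith [abs_nonneg t])
    simp [h2, h3]
  · simp only [mul_neg, φ.neg]
  · have hi : Integrable φ := φ.continuous.integrable_of_hasCompactSupport φ.hasCompactSupport
    have h2 : Integrable fun t : ℝ => φ (2 * t) := hi.comp_mul_left' (by norm_num)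
    rw [integral_sub hi (h2.const_mul 2), integral_const_mul, Measure.integral_comp_mul_left]
    simp
  · have h1 := congrFun h 0
    have h2 : φ 0 = 1 := φ.one_of_mem_closedBall (by simp [φ.rIn_pos.le])
    simp [h2] at h1
    norm_num at h1

theorem memLp_exp_neg_abs : MemLp (fun θ : ℝ => Real.exp (-(|θ| / 2))) 2 volume := by
  rw [memLp_two_iff_integrable_sq (Continuous.aestronglyMeasurable (by fun_prop))]
  refine (integrable_inv_one_add_sq.const_mul 2).mono'
    (Continuous.aestronglyMeasurable (by fun_prop)) (Eventually.of_forall fun θ => ?_)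
  -- The square e^{-|θ|} is at most 2/(1 + θ²), because e^{|θ|} ≥ 1 + |θ| + θ²/2.
  have h := Real.quadratic_le_exp_of_nonneg (abs_nonneg θ)
  rw [sq_abs] at h
  rw [Real.norm_of_nonneg (by positivity), ← Real.exp_nat_mul]
  have e : ((2 : ℕ) : ℝ) * -(|θ| / 2) = -|θ| := by push_cast; ring
  rw [e, Real.exp_neg, inv_le_comm₀ (Real.exp_pos _) (by positivity), mul_inv, inv_inv]
  linarith [abs_nonneg θ]

/-! ### Deficiency vectors and their analytic extensions. -/

/-- The common form of the deficiency vectors, `s = -1` for the atom at `0` and `s = 1` for the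
atom at `∞`. -/
def deficiencyVec (s α β : ℝ) (κ : ℝ → ℝ) (n : ℕ) (θ : ℝ) : ℂ :=
  fourierLaplace κ (Real.exp (s * θ)) *
    Complex.exp (-(Complex.I * α / 2) * Complex.exp (-θ) + (Complex.I * β / 2) * Complex.exp θ) *
    Complex.exp (s * ((n : ℂ) + 1 / 2) * θ)

theorem deficiencyVecZero_eq (α β : ℝ) (κ : ℝ → ℝ) (n : ℕ) :
    deficiencyVecZero α β κ n = deficiencyVec (-1) α β κ n := by
  ext θ
  rw [deficiencyVecZero, deficiencyVec, fourierLaplace_ofReal, neg_one_mul]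
  push_cast
  rw [neg_one_mul]

theorem deficiencyVecInfty_eq (α β : ℝ) (κ : ℝ → ℝ) (n : ℕ) :
    deficiencyVecInfty α β κ n = deficiencyVec 1 α β κ n := by
  ext θ
  rw [deficiencyVecInfty, deficiencyVec, fourierLaplace_ofReal, one_mul]
  push_cast
  rw [one_mul]

/-- The entire extension of `f ξ` for a deficiency vector `ξ`. -/
def deficiencyExt (s α β : ℝ) (κ : ℝ → ℝ) (n : ℕ) (ζ : ℂ) : ℂ :=
  fourierLaplace κ (Complex.exp (s * ζ)) *
    singularInner (α / 2) (β / 2) ζ * Complex.exp (s * ((n : ℂ) + 1 / 2) * ζ)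

theorem deficiencyExt_ofReal (s α β : ℝ) (κ : ℝ → ℝ) (n : ℕ) (θ : ℝ) :
    deficiencyExt s α β κ n θ = singularInner α β θ * deficiencyVec s α β κ n θ := by
  have h : singularInner (α / 2 : ℝ) (β / 2 : ℝ) θ = singularInner α β θ *
      Complex.exp (-(Complex.I * α / 2) * Complex.exp (-θ) +
        (Complex.I * β / 2) * Complex.exp θ) := by
    rw [singularInner, singularInner, ← Complex.exp_add]
    congr 1
    push_cast
    ring
  rw [deficiencyExt, deficiencyVec, h]
  push_cast
  ring

section Sign

variable {s α β r : ℝ} {κ : ℝ → ℝ}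

theorem exp_sign_mul_sub_pi_mul_I (hs : s = 1 ∨ s = -1) (θ : ℝ) :
    Complex.exp (s * (θ - Real.pi * Complex.I)) = -(Real.exp (s * θ) : ℝ) := by
  rcases hs with rfl | rfl
  · push_cast
    rw [one_mul, one_mul, exp_sub_pi_mul_I]
  · push_cast
    rw [neg_one_mul, neg_one_mul, exp_neg_sub_pi_mul_I]

/-- The argument e^{sζ} of the even function K changes sign and f^{1/2} turns into its conjugate
f^{-1/2}, so only the half-integer exponential leaves a factor: the eigenvalue. -/
theorem deficiencyExt_sub_pi_mul_I (hs : s = 1 ∨ s = -1) (he : ∀ t, κ (-t) = κ t) (n : ℕ)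
    (θ : ℝ) :
    deficiencyExt s α β κ n (θ - Real.pi * Complex.I) =
      Complex.exp (-(s * ((n : ℂ) + 1 / 2) * (Real.pi * Complex.I))) *
        deficiencyVec s α β κ n θ := by
  have h : (starRingEnd ℂ) (singularInner (α / 2 : ℝ) (β / 2 : ℝ) θ) =
      Complex.exp (-(Complex.I * α / 2) * Complex.exp (-θ) +
        (Complex.I * β / 2) * Complex.exp θ) := by
    rw [singularInner, ← Complex.exp_conj]
    congr 1
    simp [← Complex.exp_conj, Complex.conj_ofNat]
    ring
  have h2 : Complex.exp (s * ((n : ℂ) + 1 / 2) * (θ - Real.pi * Complex.I)) =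
      Complex.exp (-(s * ((n : ℂ) + 1 / 2) * (Real.pi * Complex.I))) *
        Complex.exp (s * ((n : ℂ) + 1 / 2) * θ) := by
    rw [← Complex.exp_add]
    congr 1
    ring
  have h3 := singularInner_sub_pi_mul_I (α / 2) (β / 2) θ
  rw [h] at h3
  rw [deficiencyExt, deficiencyVec, exp_sign_mul_sub_pi_mul_I hs, fourierLaplace_neg he, h3, h2]
  ring

theorem exp_half_integer_mul_pi_mul_I (n : ℕ) :
    Complex.exp (((n : ℂ) + 1 / 2) * (Real.pi * Complex.I)) = (-1) ^ n * Complex.I := by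
  rw [add_mul, Complex.exp_add, Complex.exp_nat_mul, Complex.exp_pi_mul_I]
  congr 1
  refine Eq.trans (congrArg Complex.exp ?_) Complex.exp_pi_div_two_mul_I
  ring

theorem differentiable_deficiencyExt (hκ : Continuous κ)
    (hsupp : Function.support κ ⊆ Set.Icc (-r) r) (n : ℕ) :
    Differentiable ℂ (deficiencyExt s α β κ n) := by
  have h1 := differentiable_fourierLaplace hκ hsupp
  have h2 := differentiable_singularInner (α / 2) (β / 2)
  exact ((h1.comp (by fun_prop)).mul h2).mul (by fun_prop)

/-- With w = e^{sζ}, K grows at most like e^{r|Im w|}, and `hr` says precisely that f^{1/2} is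
bounded by e^{-r|Im w|}. Paley–Wiener decay of order 0 suffices where |w| ≤ 1, since |w|^{n+1/2} ≤
|w|^{1/2}; order n + 1 where |w| ≥ 1 leaves |w|^{-1/2}. -/
theorem norm_deficiencyExt_le (hs : s = 1 ∨ s = -1) (hκ : ContDiff ℝ ∞ κ)
    (hsupp : Function.support κ ⊆ Set.Icc (-r) r)
    (hr : ∀ θ : ℝ, r * Real.exp (s * θ) ≤ α / 2 * Real.exp (-θ) + β / 2 * Real.exp θ) (n : ℕ) :
    ∃ C, ∀ θ y : ℝ, -Real.pi ≤ y → y ≤ 0 →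
      ‖deficiencyExt s α β κ n (θ + y * Complex.I)‖ ≤ C * Real.exp (-(|θ| / 2)) := by
  obtain ⟨C₀, h₀⟩ := pow_mul_norm_fourierLaplace_le 0 hκ hsupp
  obtain ⟨C₁, h₁⟩ := pow_mul_norm_fourierLaplace_le (n + 1) hκ hsupp
  refine ⟨max C₀ C₁, fun θ y hy1 hy2 => ?_⟩
  set w := Complex.exp (s * (θ + y * Complex.I)) with hw
  have hsin := sin_nonpos_of_mem_strip hy1 hy2
  have hwn : ‖w‖ = Real.exp (s * θ) := by
    rw [hw, Complex.norm_exp]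
    simp
  have hwim : |w.im| = Real.exp (s * θ) * -Real.sin y := by
    rw [hw, Complex.exp_im]
    have e1 : (s * (θ + y * Complex.I) : ℂ).re = s * θ := by simp
    have e2 : (s * (θ + y * Complex.I) : ℂ).im = s * y := by simp
    rw [e1, e2, abs_mul, abs_of_pos (Real.exp_pos _)]
    congr 1
    rcases hs with rfl | rfl
    · rw [one_mul, abs_of_nonpos hsin]
    · rw [neg_one_mul, Real.sin_neg, abs_neg, abs_of_nonpos hsin]
  have hE : ‖singularInner (α / 2) (β / 2) (θ + y * Complex.I)‖ ≤ Real.exp (-(r * |w.im|)) := by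
    rw [singularInner, Complex.norm_exp, re_exponent, Real.exp_le_exp, hwim]
    nlinarith [hr θ]
  have hP : ‖Complex.exp (s * ((n : ℂ) + 1 / 2) * (θ + y * Complex.I))‖ =
      Real.exp (s * θ * (n + 1 / 2)) := by
    rw [Complex.norm_exp]
    congr 1
    have e : (s * ((n : ℂ) + 1 / 2) * (θ + y * Complex.I)) =
        (s * (n + 1 / 2) * θ : ℝ) + (s * (n + 1 / 2) * y : ℝ) * Complex.I := by
      push_cast
      ring
    rw [e]
    simp
    ring
  set A := ‖fourierLaplace κ w‖ * ‖singularInner (α / 2) (β / 2) (θ + y * Complex.I)‖ with hA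
  have hbound : ∀ (N : ℕ) (C : ℝ),
      ‖w‖ ^ N * ‖fourierLaplace κ w‖ ≤ C * Real.exp (r * |w.im|) →
      Real.exp (s * θ) ^ N * A ≤ C := fun N C h => by
    rw [hwn] at h
    calc Real.exp (s * θ) ^ N * A
        = (Real.exp (s * θ) ^ N * ‖fourierLaplace κ w‖) *
            ‖singularInner (α / 2) (β / 2) (θ + y * Complex.I)‖ := by rw [hA]; ring
      _ ≤ (C * Real.exp (r * |w.im|)) * Real.exp (-(r * |w.im|)) :=
          mul_le_mul h hE (norm_nonneg _) ((by positivity : (0 : ℝ) ≤ _).trans h)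
      _ = C := by rw [mul_assoc, ← Real.exp_add, add_neg_cancel, Real.exp_zero, mul_one]
  have b₀ := (hbound 0 C₀ (h₀ w)).trans (le_max_left C₀ C₁)
  have b₁ := (hbound (n + 1) C₁ (h₁ w)).trans (le_max_right C₀ C₁)
  rw [pow_zero, one_mul] at b₀
  have hA0 : 0 ≤ A := by positivity
  have habs : |θ| = |s * θ| := by
    rcases hs with rfl | rfl <;> simp
  have hn : (0 : ℝ) ≤ n := n.cast_nonneg
  rw [deficiencyExt, norm_mul, norm_mul, hP, habs]
  rcases le_total 0 (s * θ) with h | h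
  · rw [abs_of_nonneg h]
    have e : Real.exp (s * θ * (n + 1 / 2)) =
        Real.exp (s * θ) ^ (n + 1) * Real.exp (-(s * θ / 2)) := by
      rw [← Real.exp_nat_mul, ← Real.exp_add]
      congr 1
      push_cast
      ring
    rw [e, ← mul_assoc, mul_comm _ (Real.exp (s * θ) ^ (n + 1))]
    exact mul_le_mul_of_nonneg_right b₁ (Real.exp_pos _).le
  · rw [abs_of_nonpos h]
    refine mul_le_mul b₀ (Real.exp_le_exp.2 ?_) (Real.exp_pos _).le (hA0.trans b₀)
    nlinarith

theorem deficiencyVec_mem_eigenspace (hs : s = 1 ∨ s = -1) (hκ : ContDiff ℝ ∞ κ)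
    (hsupp : Function.support κ ⊆ Set.Icc (-r) r) (he : ∀ t, κ (-t) = κ t)
    (hr : ∀ θ : ℝ, r * Real.exp (s * θ) ≤ α / 2 * Real.exp (-θ) + β / 2 * Real.exp θ) (n : ℕ) :
    ∃ h : MemLp (deficiencyVec s α β κ n) 2 volume,
      h.toLp ∈ eigenspace (boundStateOp α β).adjoint
        (Complex.exp (-(s * ((n : ℂ) + 1 / 2) * (Real.pi * Complex.I)))) := by
  have hd := differentiable_deficiencyExt (s := s) (α := α) (β := β) hκ.continuous hsupp n
  obtain ⟨C, hC⟩ := norm_deficiencyExt_le hs hκ hsupp hr n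
  obtain ⟨g, η, hG, hg, hη⟩ :=
    exists_hasBoundaryValues_of_dominated hd (memLp_exp_neg_abs.const_mul C) hC
  -- The vector is a constant multiple of the lower boundary value η, so it inherits square
  -- integrability.
  have hm : MemLp (deficiencyVec s α β κ n) 2 volume := by
    refine ((Lp.memLp η).const_mul
      (Complex.exp (s * ((n : ℂ) + 1 / 2) * (Real.pi * Complex.I)))).ae_eq ?_
    filter_upwards [hη] with θ h
    rw [h, deficiencyExt_sub_pi_mul_I hs he, ← mul_assoc, ← Complex.exp_add, add_neg_cancel,
      Complex.exp_zero, one_mul]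
  refine ⟨hm, mem_eigenspace_adjoint (G := deficiencyExt s α β κ n) (g := g) ?_ ?_⟩
  · convert hG
    refine Lp.ext ?_
    filter_upwards [hη, hm.coeFn_toLp, Lp.coeFn_smul
      (Complex.exp (-(s * ((n : ℂ) + 1 / 2) * (Real.pi * Complex.I)))) hm.toLp] with θ h1 h2 h3
    rw [h1, h3, Pi.smul_apply, h2, deficiencyExt_sub_pi_mul_I hs he, smul_eq_mul]
  · filter_upwards [hg, hm.coeFn_toLp] with θ h1 h2
    rw [h1, h2, deficiencyExt_ofReal]

/-- A vanishing combination says K(x)P(x) = 0 for x = e^{sθ}, with P the polynomial of the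
coefficients; since K is entire and nonzero, isolated zeros force P = 0. -/
theorem linearIndependent_deficiencyVec (hs : s = 1 ∨ s = -1) (hκ : Continuous κ)
    (hsupp : Function.support κ ⊆ Set.Icc (-r) r)
    (h : ∀ n, MemLp (deficiencyVec s α β κ n) 2 volume) (h0 : κ ≠ 0) :
    LinearIndependent ℂ fun n => (h n).toLp := by
  have hK := differentiable_fourierLaplace hκ hsupp
  rw [linearIndependent_iff']
  intro S c hsum
  set P : Polynomial ℂ := ∑ n ∈ S, Polynomial.monomial n (c n) with hP
  have hmul : ∀ θ : ℝ, fourierLaplace κ (Real.exp (s * θ)) *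
      P.eval (Real.exp (s * θ) : ℂ) = 0 := by
    have hae : ∀ᵐ θ : ℝ, fourierLaplace κ (Real.exp (s * θ)) *
        P.eval (Real.exp (s * θ) : ℂ) = 0 := by
      have h1 : (∑ n ∈ S, c n • (h n).toLp : L2) =ᵐ[volume] 0 := by
        rw [hsum]
        exact Lp.coeFn_zero _ _ _
      have h2 : ∀ᵐ θ : ℝ, ∀ n, (c n • (h n).toLp : L2) θ = c n * deficiencyVec s α β κ n θ :=
        ae_all_iff.2 fun n => by
          filter_upwards [Lp.coeFn_smul (c n) (h n).toLp, (h n).coeFn_toLp] with θ h3 h4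
          rw [h3, Pi.smul_apply, h4, smul_eq_mul]
      filter_upwards [h1, h2, Lp.coeFn_finsetSum S fun n => c n • (h n).toLp] with θ h3 h4 h5
      rw [h5, Finset.sum_apply] at h3
      simp only [h4, Pi.zero_apply, deficiencyVec] at h3
      have e : ∀ n : ℕ, Complex.exp (s * ((n : ℂ) + 1 / 2) * θ) =
          (Real.exp (s * θ) : ℂ) ^ n * Complex.exp (s * θ / 2) := fun n => by
        rw [Complex.ofReal_exp, ← Complex.exp_nat_mul, ← Complex.exp_add]
        congr 1
        push_cast
        ring
      have e2 : ∑ n ∈ S, c n * (fourierLaplace κ (Real.exp (s * θ)) *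
          Complex.exp (-(Complex.I * α / 2) * Complex.exp (-θ) +
            (Complex.I * β / 2) * Complex.exp θ) *
          Complex.exp (s * ((n : ℂ) + 1 / 2) * θ)) =
          (fourierLaplace κ (Real.exp (s * θ)) * P.eval (Real.exp (s * θ) : ℂ)) *
          (Complex.exp (-(Complex.I * α / 2) * Complex.exp (-θ) +
            (Complex.I * β / 2) * Complex.exp θ) * Complex.exp (s * θ / 2)) := by
        rw [hP, Polynomial.eval_finsetSum, Finset.mul_sum, Finset.sum_mul]
        refine Finset.sum_congr rfl fun n _ => ?_
        rw [e n, Polynomial.eval_monomial]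
        ring
      rw [e2] at h3
      exact (mul_eq_zero.1 h3).resolve_right
        (mul_ne_zero (Complex.exp_ne_zero _) (Complex.exp_ne_zero _))
    have hc : Continuous fun θ : ℝ => fourierLaplace κ (Real.exp (s * θ)) *
        P.eval (Real.exp (s * θ) : ℂ) := by
      have h1 := hK.continuous
      have h2 := P.continuous
      exact Continuous.mul (by fun_prop) (by fun_prop)
    exact congrFun ((Continuous.ae_eq_iff_eq volume hc continuous_const).1 hae)
  have hKa : AnalyticOnNhd ℂ (fourierLaplace κ) Set.univ := fun z _ => hK.analyticAt z
  have hPa : AnalyticOnNhd ℂ (fun z => P.eval z) Set.univ := fun z _ => P.differentiable.analyticAt z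
  have hPzero : P = 0 := by
    rcases (hPa 1 trivial).eventually_eq_zero_or_eventually_ne_zero with hp | hp
    · exact Polynomial.funext fun z => by
        simpa using congrFun (hPa.eq_of_eventuallyEq (analyticOnNhd_const (v := 0)) hp) z
    rcases (hKa 1 trivial).eventually_eq_zero_or_eventually_ne_zero with hk | hk
    · exact absurd (eq_zero_of_fourierLaplace_eq_zero hκ hsupp
        (hKa.eq_of_eventuallyEq (analyticOnNhd_const (v := 0)) hk)) h0
    -- If neither K nor P vanishes identically near 1, both are nonzero on a punctured neighbourhood
    -- of 1, which e^{sθ} enters as θ → 0 with θ ≠ 0.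
    exfalso
    have hne := hk.and hp
    rw [eventually_nhdsWithin_iff] at hne
    have hs0 : s ≠ 0 := by rcases hs with rfl | rfl <;> norm_num
    have hlim : Tendsto (fun θ : ℝ => (Real.exp (s * θ) : ℂ)) (𝓝[≠] 0) (𝓝 1) := by
      have : Continuous fun θ : ℝ => (Real.exp (s * θ) : ℂ) := by fun_prop
      have := this.tendsto 0
      simp only [mul_zero, Real.exp_zero, Complex.ofReal_one] at this
      exact this.mono_left nhdsWithin_le_nhds
    obtain ⟨θ, h1, h2⟩ := ((hlim.eventually hne).and self_mem_nhdsWithin).exists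
    have h3 := h1 (by
      intro h4
      have h5 : Real.exp (s * θ) = 1 := by exact_mod_cast Set.mem_singleton_iff.1 h4
      exact (mul_ne_zero hs0 h2) (Real.exp_eq_one_iff _ |>.1 h5))
    exact (mul_ne_zero h3.1 h3.2) (hmul θ)
  intro n hn
  have := congrArg (fun Q => Polynomial.coeff Q n) hPzero
  simpa [hP, Polynomial.finsetSum_coeff, Polynomial.coeff_monomial, hn] using this

end Sign

/-! ### The two families and the deficiency indices. -/

section Deficiency

variable {α β : ℝ} {κ : ℝ → ℝ}

theorem deficiencyVecZero_spec (hα : 0 ≤ α) (hβ : 0 ≤ β) (hκ : IsTestFunction (α / 3) κ) :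
    ∃ h : ∀ n : ℕ, MemLp (deficiencyVecZero α β κ n) 2 volume,
      (∀ n : ℕ, (h n).toLp ∈ eigenspace (boundStateOp α β).adjoint ((-1) ^ n * Complex.I)) ∧
      (κ ≠ 0 → LinearIndependent ℂ (fun n : ℕ => (h n).toLp)) := by
  have hsupp := hκ.supp.trans Set.Ioo_subset_Icc_self
  -- The atom at 0 alone absorbs the growth, as α/3 ≤ α/2.
  have hr : ∀ θ : ℝ, α / 3 * Real.exp (-1 * θ) ≤
      α / 2 * Real.exp (-θ) + β / 2 * Real.exp θ := fun θ => by
    rw [neg_one_mul]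
    have h1 := mul_nonneg hα (Real.exp_pos (-θ)).le
    have h2 := mul_nonneg hβ (Real.exp_pos θ).le
    linarith
  simp only [deficiencyVecZero_eq]
  choose h hmem using deficiencyVec_mem_eigenspace (Or.inr rfl) hκ.smooth hsupp hκ.even hr
  refine ⟨h, fun n => ?_, linearIndependent_deficiencyVec (Or.inr rfl) hκ.smooth.continuous hsupp h⟩
  convert hmem n using 2
  rw [← exp_half_integer_mul_pi_mul_I]
  congr 1
  push_cast
  ring

theorem deficiencyVecInfty_spec (hα : 0 ≤ α) (hβ : 0 ≤ β) (hκ : IsTestFunction (β / 3) κ) :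
    ∃ h : ∀ n : ℕ, MemLp (deficiencyVecInfty α β κ n) 2 volume,
      (∀ n : ℕ, (h n).toLp ∈ eigenspace (boundStateOp α β).adjoint
        ((-1) ^ (n + 1) * Complex.I)) ∧
      (κ ≠ 0 → LinearIndependent ℂ (fun n : ℕ => (h n).toLp)) := by
  have hsupp := hκ.supp.trans Set.Ioo_subset_Icc_self
  have hr : ∀ θ : ℝ, β / 3 * Real.exp (1 * θ) ≤
      α / 2 * Real.exp (-θ) + β / 2 * Real.exp θ := fun θ => by
    rw [one_mul]
    have h1 := mul_nonneg hα (Real.exp_pos (-θ)).le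
    have h2 := mul_nonneg hβ (Real.exp_pos θ).le
    linarith
  simp only [deficiencyVecInfty_eq]
  choose h hmem using deficiencyVec_mem_eigenspace (Or.inl rfl) hκ.smooth hsupp hκ.even hr
  refine ⟨h, fun n => ?_, linearIndependent_deficiencyVec (Or.inl rfl) hκ.smooth.continuous hsupp h⟩
  convert hmem n using 2
  -- For s = 1 the eigenvalue is the inverse of the one for s = -1; since i⁻¹ = -i, the exponent of
  -- -1 becomes n + 1.
  rw [Complex.ofReal_one, one_mul, Complex.exp_neg, exp_half_integer_mul_pi_mul_I, mul_inv,
    Complex.inv_I, ← inv_pow, pow_succ]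
  norm_num

theorem toENat_rank_eq_top {E : Submodule ℂ L2} {v : ℕ → L2} (hv : LinearIndependent ℂ v)
    {k : ℕ → ℕ} (hk : Function.Injective k) (hmem : ∀ n, v (k n) ∈ E) :
    Cardinal.toENat (Module.rank ℂ E) = ⊤ := by
  have h : LinearIndependent ℂ fun n => (⟨v (k n), hmem n⟩ : E) :=
    LinearIndependent.of_comp E.subtype (hv.comp k hk)
  exact Cardinal.toENat_eq_top.2 h.aleph0_le_rank

/-- One family is enough: its even and odd members lie in opposite deficiency spaces, with the roles
of the parities exchanged between the two atoms. -/
theorem deficiency_eq_top (hα : 0 ≤ α) (hβ : 0 ≤ β) (hαβ : α ≠ 0 ∨ β ≠ 0) :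
    deficiencyPlus (boundStateOp α β) = ⊤ ∧ deficiencyMinus (boundStateOp α β) = ⊤ := by
  have even_inj : Function.Injective fun n : ℕ => 2 * n := fun a b h => by simpa using h
  have odd_inj : Function.Injective fun n : ℕ => 2 * n + 1 := fun a b h => by simpa using h
  rcases hαβ with h | h
  · have hpos := lt_of_le_of_ne hα h.symm
    obtain ⟨κ, hκ, h0⟩ := exists_isTestFunction (r := α / 3) (by positivity)
    obtain ⟨hm, heig, hlin⟩ := deficiencyVecZero_spec hα hβ hκ
    refine ⟨toENat_rank_eq_top (hlin h0) even_inj fun n => ?_,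
      toENat_rank_eq_top (hlin h0) odd_inj fun n => ?_⟩
    · simpa [pow_mul] using heig (2 * n)
    · simpa [pow_mul, pow_succ] using heig (2 * n + 1)
  · have hpos := lt_of_le_of_ne hβ h.symm
    obtain ⟨κ, hκ, h0⟩ := exists_isTestFunction (r := β / 3) (by positivity)
    obtain ⟨hm, heig, hlin⟩ := deficiencyVecInfty_spec hα hβ hκ
    refine ⟨toENat_rank_eq_top (hlin h0) odd_inj fun n => ?_,
      toENat_rank_eq_top (hlin h0) even_inj fun n => ?_⟩
    · simpa [pow_mul, pow_succ] using heig (2 * n + 1)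
    · simpa [pow_mul, pow_succ] using heig (2 * n)

end Deficiency

end StripOperator

end

theorem mainTheorem7 (α β : ℝ) (hα : 0 ≤ α) (hβ : 0 ≤ β) (hαβ : α ≠ 0 ∨ β ≠ 0) :
    Dense ((StripOperator.boundStateOp α β).domain : Set StripOperator.L2) ∧
    (StripOperator.boundStateOp α β).IsFormalAdjoint (StripOperator.boundStateOp α β) ∧
    StripOperator.deficiencyPlus (StripOperator.boundStateOp α β) = ⊤ ∧
    StripOperator.deficiencyMinus (StripOperator.boundStateOp α β) = ⊤ ∧
    (0 < α → ∀ κ : ℝ → ℝ, StripOperator.IsTestFunction (α / 3) κ →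
      ∃ h : ∀ n : ℕ, MemLp (StripOperator.deficiencyVecZero α β κ n) 2 volume,
        (∀ n : ℕ, (h n).toLp ∈ StripOperator.eigenspace
          (StripOperator.boundStateOp α β).adjoint ((-1) ^ n * Complex.I)) ∧
        (κ ≠ 0 → LinearIndependent ℂ (fun n : ℕ => (h n).toLp))) ∧
    (0 < β → ∀ κ : ℝ → ℝ, StripOperator.IsTestFunction (β / 3) κ →
      ∃ h : ∀ n : ℕ, MemLp (StripOperator.deficiencyVecInfty α β κ n) 2 volume,
        (∀ n : ℕ, (h n).toLp ∈ StripOperator.eigenspace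
          (StripOperator.boundStateOp α β).adjoint ((-1) ^ (n + 1) * Complex.I)) ∧
        (κ ≠ 0 → LinearIndependent ℂ (fun n : ℕ => (h n).toLp))) := by
  obtain ⟨h1, h2⟩ := StripOperator.deficiency_eq_top hα hβ hαβ
  exact ⟨StripOperator.dense_domain_boundStateOp,
    StripOperator.boundStateOp_isFormalAdjoint hα hβ, h1, h2,
    fun _ _ hκ => StripOperator.deficiencyVecZero_spec hα hβ hκ,
    fun _ _ hκ => StripOperator.deficiencyVecInfty_spec hα hβ hκ⟩
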